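/- **Conventions.** $\mathbb{CH}^n$ is the unit ball $\mathbb{B}^n\subset\mathbb{C}^n$ with $(z,w)=\sum_i z_i\overline{w_i}$, automorphism group $PU(n,1)$ (acting by fractional linear maps) and distance $\beta=\operatorname{artanh}\rho$, where $\rho(z,w)^2=1-\frac{(1-|z|^2)(1-|w|^2)}{|1-(z,w)|^2}$. A *complex geodesic* is the image of the slice $\{(\zeta,0,\dots,0):|\zeta|<1\}$ under an automorphism. Area in a complex geodesic is the hyperbolic area of curvature $-1$, i.e. the area transported from the disk, where the area element is $\frac{4\,dx\,dy}{(1-|\zeta|^2)^2}$. The symplectic form is $$\omega_z(u,v)=\frac{4\operatorname{Im}\big((1-|z|^2)\langle u,v\rangle+\langle u,z\rangle\langle z,v\rangle\big)}{(1-|z|^2)^2},\qquad \langle u,v\rangle=\sum_i\overline{u_i}v_i,$$ which on the disk is this area form. For $a,b,c\in\mathbb{CH}^n$ let $\Delta$ be the geodesic triangle with these vertices. Its *symplectic area* is $\mathcal{SA}(\Delta)=\int_\Sigma\omega$, where $\Sigma$ is any smooth surface spanning $\Delta$ (a smooth map of the closed unit square into $\mathbb{CH}^n$ that collapses one edge to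 the vertex $a$ and carries the other three edges onto the sides $ab$, $bc$, $ac$ of $\Delta$). The *angular invariant* is $A(x,y,z)=\arg(k_{xy}k_{yz}k_{zx})\in(-\pi,\pi]$ with $k_{xy}=\frac{1}{1-(y,x)}$. **Theorem 5.7.** Let $X=\{x_1,x_2,x_3\}$ be a set of three distinct points of $\mathbb{CH}^n$, let $\Delta_X$ be the geodesic triangle with vertices $x_1,x_2,x_3$, and put $A_{123}=A(x_1,x_2,x_3)$. Spanning surfaces of $\Delta_X$ exist, and $\mathcal{SA}(\Delta_X)$ does not depend on the one that is used. Each side of $\Delta_X$ lies in a unique complex geodesic $G$, and each $x_k$ has a unique nearest point $\Pi x_k$ in $G$. Let $\Delta_{\Pi X}\subset G$ be the solid geodesic triangle with vertices $\Pi x_1,\Pi x_2,\Pi x_3$. Then, whichever side was chosen, $$\tfrac12\operatorname{Area}(\Delta_{\Pi X})=\left|\mathcal{SA}(\Delta_X)/2\right|=|A_{123}|.$$ -/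

import Mathlib

open scoped ContDiff ENNReal

noncomputable section

namespace CHyp

/-- The ambient complex Euclidean space of the ball model of `CH^n`. -/
abbrev Cn (n : ℕ) : Type := EuclideanSpace ℂ (Fin n)

/-- The open unit ball of `ℂ^n`: the underlying set of complex hyperbolic space `CH^n`. -/
def ball (n : ℕ) : Set (Cn n) := Metric.ball 0 1

/-- The open unit disk of `ℂ`: the underlying set of `CH^1`. -/
def disk : Set ℂ := Metric.ball 0 1

/-! ### Metric, geodesics, triangles -/

/-- The pseudohyperbolic metric of the ball,
`ρ(z,w)² = 1 - (1-|z|²)(1-|w|²)/|1-(z,w)|²`. It satisfies `ρ(0,z) = |z|` and is invariant under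
the automorphisms of the ball. -/
def rho {n : ℕ} (z w : Cn n) : ℝ :=
  Real.sqrt (1 - (1 - ‖z‖ ^ 2) * (1 - ‖w‖ ^ 2) / ‖1 - inner ℂ z w‖ ^ 2)

/-- The Bergman-Poincare distance `β = artanh ρ` of the ball, equivalently
`cosh β(z,w) = |1-(z,w)| / √((1-|z|²)(1-|w|²))`. It is the length metric generated by `ρ`, the
distance function of the invariant Riemannian metric that is Euclidean at the origin. -/
def beta {n : ℕ} (z w : Cn n) : ℝ := Real.artanh (rho z w)

/-- The geodesic segment with endpoints `p` and `q`: the points of `CH^n` lying metrically between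
`p` and `q`. -/
def geodesicSegment {n : ℕ} (p q : Cn n) : Set (Cn n) :=
  {z | z ∈ ball n ∧ beta p z + beta z q = beta p q}

/-- The solid triangle with vertices `a, b, c`: the union of the geodesic segments that join `a`
to the points of the opposite side. For three points of a complex geodesic (a hyperbolic plane)
this is the region bounded by the geodesic triangle, together with its boundary. -/
def solidTriangle {n : ℕ} (a b c : Cn n) : Set (Cn n) :=
  {z | ∃ w ∈ geodesicSegment b c, z ∈ geodesicSegment a w}

/-- `p` is a point of `G` nearest to `x` in the hyperbolic metric. -/
def IsNearestPoint {n : ℕ} (G : Set (Cn n)) (x p : Cn n) : Prop :=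
  p ∈ G ∧ ∀ q ∈ G, beta x p ≤ beta x q

/-! ### Automorphisms and complex geodesics -/

/-- The Hermitian form of signature `(n,1)` on `ℂ^n × ℂ = ℂ^(n+1)`,
`[x,y] = ∑ i ≤ n, x_i conj(y_i) - x_(n+1) conj(y_(n+1))`. -/
def form {n : ℕ} (x y : Cn n × ℂ) : ℂ :=
  inner ℂ y.1 x.1 - x.2 * (starRingEnd ℂ) y.2

/-- `f` is (on the ball) an automorphism of `CH^n`: the projective action, in the affine chart
`z ↦ (z,1)`, of a linear automorphism of `ℂ^(n+1)` that preserves the Hermitian form. -/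
def IsBallAut {n : ℕ} (f : Cn n → Cn n) : Prop :=
  ∃ T : (Cn n × ℂ) ≃ₗ[ℂ] (Cn n × ℂ),
    (∀ u v, form (T u) (T v) = form u v) ∧
    ∀ z ∈ ball n, f z = (T (z, 1)).2⁻¹ • (T (z, 1)).1

/-- The point `(ζ, 0, …, 0)` of `ℂ^n`. -/
def axis (n : ℕ) (ζ : ℂ) : Cn n :=
  WithLp.toLp 2 (fun k : Fin n => if (k : ℕ) = 0 then ζ else 0)

/-- `ψ` is an isometric holomorphic parametrization of `G` by the disk `CH^1`: an automorphism of
`CH^n` restricted to the slice `{(ζ, 0, …, 0) : |ζ| < 1}`, with image `G`. -/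
def IsDiskChart {n : ℕ} (ψ : ℂ → Cn n) (G : Set (Cn n)) : Prop :=
  (∃ f : Cn n → Cn n, IsBallAut f ∧ ∀ ζ ∈ disk, ψ ζ = f (axis n ζ)) ∧ G = ψ '' disk

/-- A complex geodesic of `CH^n`: the image of the slice `{(ζ, 0, …, 0) : |ζ| < 1}` under an
automorphism. -/
def IsComplexGeodesic {n : ℕ} (G : Set (Cn n)) : Prop := ∃ ψ : ℂ → Cn n, IsDiskChart ψ G

/-! ### Area and symplectic area -/

/-- Hyperbolic area of a subset of the disk, for the Poincare metric of curvature `-1`, whose area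
element is `4 dx dy / (1-|ζ|²)²`. -/
def hypArea (S : Set ℂ) : ℝ≥0∞ :=
  ∫⁻ ζ in S, ENNReal.ofReal (4 / (1 - ‖ζ‖ ^ 2) ^ 2)

/-- The symplectic (Kaehler) form of `CH^n` at `z`, applied to the tangent vectors `u, v`,
`4 Im ((1-|z|²) ⟨u,v⟩ + ⟨u,z⟩⟨z,v⟩) / (1-|z|²)²` with `⟨u,v⟩ = ∑ conj(u_i) v_i`. It is normalized so
that for `n = 1` it is the area form `4 dx ∧ dy / (1-|z|²)²` of curvature `-1`. -/
def omega {n : ℕ} (z u v : Cn n) : ℝ :=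
  4 * (((1 - ‖z‖ ^ 2 : ℝ) : ℂ) * inner ℂ u v + inner ℂ u z * inner ℂ z v).im /
    (1 - ‖z‖ ^ 2) ^ 2

/-- The closed unit square. -/
def square : Set (ℝ × ℝ) := Set.Icc 0 1 ×ˢ Set.Icc 0 1

/-- `σ` is a smooth surface in `CH^n` spanning the geodesic triangle with vertices `a, b, c`,
parametrized by the unit square: the edge `s = 0` is collapsed to the vertex `a`, and the other
three edges run along the sides `ab`, `bc`, `ac`. -/
structure IsSpanningSurface {n : ℕ} (a b c : Cn n) (σ : ℝ × ℝ → Cn n) : Prop where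
  smooth : ContDiffOn ℝ ∞ σ square
  mem_ball : ∀ p ∈ square, σ p ∈ ball n
  vertex_a : ∀ t ∈ Set.Icc (0 : ℝ) 1, σ (0, t) = a
  vertex_b : σ (1, 0) = b
  vertex_c : σ (1, 1) = c
  side_ab : ∀ s ∈ Set.Icc (0 : ℝ) 1, σ (s, 0) ∈ geodesicSegment a b
  side_bc : ∀ t ∈ Set.Icc (0 : ℝ) 1, σ (1, t) ∈ geodesicSegment b c
  side_ac : ∀ s ∈ Set.Icc (0 : ℝ) 1, σ (s, 1) ∈ geodesicSegment a c

/-- The integral of the symplectic form over a surface parametrized by the unit square. -/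
def integralOmega {n : ℕ} (σ : ℝ × ℝ → Cn n) : ℝ :=
  ∫ p in square, omega (σ p) (fderivWithin ℝ σ square p (1, 0)) (fderivWithin ℝ σ square p (0, 1))

/-- The symplectic area of the geodesic triangle with vertices `a, b, c` is (well defined and)
equal to `A`: spanning surfaces exist, and the integral of the symplectic form over each of them
is `A`. -/
def HasSymplecticArea {n : ℕ} (a b c : Cn n) (A : ℝ) : Prop :=
  (∃ σ, IsSpanningSurface a b c σ) ∧ ∀ σ, IsSpanningSurface a b c σ → integralOmega σ = A

/-! ### The angular invariant -/

/-- The Drury-Arveson kernel entry `k_xy = k_x(y) = 1 / (1 - (y,x))`, `(y,x) = ∑ y_i conj(x_i)`. -/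
def kernel {n : ℕ} (x y : Cn n) : ℂ := 1 / (1 - inner ℂ x y)

/-- The angular invariant `A(x,y,z) = arg (k_xy k_yz k_zx)`. -/
def angularInvariant {n : ℕ} (x y z : Cn n) : ℝ :=
  Complex.arg (kernel x y * kernel y z * kernel z x)

end CHyp

end

noncomputable section

namespace CHyp

variable {n : ℕ}

/-! ### The Hermitian form and its automorphisms -/

/-! Both quantities are compared with the angular invariant `A`. The form `eta` is a primitive of
`omega` on the ball, so Stokes' theorem (`integralOmega_eq_boundary`) reduces the symplectic area to
integrals of `eta` along the three sides. If `z` and `w` lie on a geodesic segment starting at `p`,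
the triple product of `z`, `w`, `p` is real. Differentiating this relation shows that, along the
segment, `eta` is the differential of `-2 arg (1 - inner p γ)`. So `integral_eta_segment` gives each
side in closed form. The three arguments add up to that of the triple product, with no multiple of
`2π` since all these numbers have positive real part. Hence every spanning surface has integral
`2A`.

For the area, an automorphism turns the complex geodesic `G` into the first coordinate axis, where
the nearest point projection is the first coordinate (`isNearestPoint_slice_iff`). Two vertices are
on `G`, so every pair of distinct vertices contains one that is; an inner product with a point of
the axis sees only first coordinates. Projection therefore preserves all three inner products, hence
`A`.

It remains to treat a triangle in the disk. A Möbius map moves one vertex to `0`, and the solid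
triangle becomes the cone over the opposite side. This cone is itself a spanning surface, its
Jacobian has constant sign (`diskGeo_im`), and it is injective on the open square unless it is
degenerate (`cone_injOn`). Change of variables then identifies its area with the absolute value of
its symplectic integral, that is `|2A|`. -/

lemma mem_ball_iff {z : Cn n} : z ∈ ball n ↔ ‖z‖ < 1 := by simp [ball]

lemma normSq_lt_one {z : Cn n} (hz : z ∈ ball n) : ‖z‖ ^ 2 < 1 := by
  have := mem_ball_iff.1 hz
  nlinarith [norm_nonneg z]

lemma zero_mem_ball : (0 : Cn n) ∈ ball n := by simp [ball]

lemma form_add_left (x y z : Cn n × ℂ) : form (x + y) z = form x z + form y z := by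
  simp [form]; ring

lemma form_smul_left (c : ℂ) (x z : Cn n × ℂ) : form (c • x) z = c * form x z := by
  simp [form]; ring

lemma form_conj (x y : Cn n × ℂ) : (starRingEnd ℂ) (form x y) = form y x := by
  simp [form, inner_conj_symm]; ring

lemma form_add_right (x y z : Cn n × ℂ) : form z (x + y) = form z x + form z y := by
  simp [form]; ring

lemma form_smul_right (c : ℂ) (x z : Cn n × ℂ) :
    form z (c • x) = (starRingEnd ℂ) c * form z x := by
  simp [form]; ring

lemma inner_self_ofReal (z : Cn n) : inner ℂ z z = ((‖z‖ ^ 2 : ℝ) : ℂ) := by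
  rw [inner_self_eq_norm_sq_to_K]; push_cast; rfl

lemma form_self (u : Cn n × ℂ) : form u u = ((‖u.1‖ ^ 2 - ‖u.2‖ ^ 2 : ℝ) : ℂ) := by
  rw [form, inner_self_ofReal, Complex.mul_conj, Complex.normSq_eq_norm_sq]
  push_cast; rfl

lemma form_lift (z w : Cn n) : form (z, 1) (w, 1) = inner ℂ w z - 1 := by simp [form]

/-- The projective action of a linear automorphism of `ℂ^(n+1)` in the chart `z ↦ (z, 1)`. -/
def act (T : (Cn n × ℂ) ≃ₗ[ℂ] (Cn n × ℂ)) (z : Cn n) : Cn n :=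
  (T (z, 1)).2⁻¹ • (T (z, 1)).1

/-- `T` preserves the Hermitian form. -/
def Preserves (T : (Cn n × ℂ) ≃ₗ[ℂ] (Cn n × ℂ)) : Prop :=
  ∀ u v, form (T u) (T v) = form u v

section act

variable {T : (Cn n × ℂ) ≃ₗ[ℂ] (Cn n × ℂ)}

lemma Preserves.symm (hT : Preserves T) : Preserves T.symm := fun u v => by
  rw [← hT, T.apply_symm_apply, T.apply_symm_apply]

lemma Preserves.trans {S : (Cn n × ℂ) ≃ₗ[ℂ] (Cn n × ℂ)} (hT : Preserves T) (hS : Preserves S) :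
    Preserves (T.trans S) := fun u v => by
  rw [LinearEquiv.trans_apply, LinearEquiv.trans_apply, hS, hT]

/-- Lifts of ball points are negative vectors, and a vector with vanishing last coordinate is not.
-/
lemma snd_ne_zero (hT : Preserves T) {z : Cn n} (hz : z ∈ ball n) : (T (z, 1)).2 ≠ 0 := by
  intro h
  have h1 := hT (z, 1) (z, 1)
  rw [form_self, form_self, h] at h1
  have h2 := Complex.ofReal_injective h1
  have := normSq_lt_one hz
  simp at h2
  nlinarith [sq_nonneg ‖(T (z, 1)).1‖]

lemma lift_act (hT : Preserves T) {z : Cn n} (hz : z ∈ ball n) :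
    T (z, 1) = (T (z, 1)).2 • (act T z, (1 : ℂ)) := by
  have h := snd_ne_zero hT hz
  ext1
  · simp [act, smul_smul, h]
  · simp

lemma act_eq_of_lift {z w : Cn n} {c : ℂ} (hc : c ≠ 0) (h : T (z, 1) = c • (w, (1 : ℂ))) :
    act T z = w := by
  simp [act, h, smul_smul, hc]

/-- The last coordinate of `T (z, 1)` is an automorphy factor, pulled out of the preserved form. The
invariance of `ball`, `rho` and `angularInvariant` all comes from this law. -/
lemma act_inner (hT : Preserves T) {z w : Cn n} (hz : z ∈ ball n) (hw : w ∈ ball n) :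
    (T (w, 1)).2 * (starRingEnd ℂ) (T (z, 1)).2 * (1 - inner ℂ (act T z) (act T w))
      = 1 - inner ℂ z w := by
  have h := hT (w, 1) (z, 1)
  rw [lift_act hT hz, lift_act hT hw, form_smul_left, form_smul_right, form_lift, form_lift] at h
  linear_combination -h

lemma act_normSq (hT : Preserves T) {z : Cn n} (hz : z ∈ ball n) :
    ‖(T (z, 1)).2‖ ^ 2 * (1 - ‖act T z‖ ^ 2) = 1 - ‖z‖ ^ 2 := by
  have h := act_inner hT hz hz
  rw [inner_self_ofReal, inner_self_ofReal, Complex.mul_conj,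
    Complex.normSq_eq_norm_sq] at h
  exact_mod_cast h

lemma act_mem (hT : Preserves T) {z : Cn n} (hz : z ∈ ball n) : act T z ∈ ball n := by
  have h := act_normSq hT hz
  have h1 := normSq_lt_one hz
  have h2 : 0 < ‖(T (z, 1)).2‖ ^ 2 := by
    have := snd_ne_zero hT hz
    positivity
  have h3 : 0 < 1 - ‖act T z‖ ^ 2 := by
    by_contra h4
    nlinarith [mul_nonneg h2.le (neg_nonneg.2 (not_lt.1 h4))]
  rw [mem_ball_iff]
  nlinarith [norm_nonneg (act T z)]

lemma act_symm_act (hT : Preserves T) {z : Cn n} (hz : z ∈ ball n) :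
    act T.symm (act T z) = z := by
  have h := snd_ne_zero hT hz
  refine act_eq_of_lift (inv_ne_zero h) ?_
  rw [LinearEquiv.symm_apply_eq, map_smul, lift_act hT hz, smul_smul]
  simp [h]

lemma act_act_symm (hT : Preserves T) {z : Cn n} (hz : z ∈ ball n) :
    act T (act T.symm z) = z := by
  simpa using act_symm_act hT.symm hz

lemma rho_act (hT : Preserves T) {z w : Cn n} (hz : z ∈ ball n) (hw : w ∈ ball n) :
    rho (act T z) (act T w) = rho z w := by
  have h1 := snd_ne_zero hT hz
  have h2 := snd_ne_zero hT hw
  unfold rho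
  rw [← act_normSq hT hz, ← act_normSq hT hw, ← act_inner hT hz hw, norm_mul, norm_mul,
    RCLike.norm_conj]
  congr 2
  rw [mul_pow, mul_pow, ← mul_div_mul_left _ _ (c := ‖(T (w, 1)).2‖ ^ 2 * ‖(T (z, 1)).2‖ ^ 2)]
  · congr 1; ring
  · positivity

lemma beta_act (hT : Preserves T) {z w : Cn n} (hz : z ∈ ball n) (hw : w ∈ ball n) :
    beta (act T z) (act T w) = beta z w := by
  rw [beta, rho_act hT hz hw, beta]

lemma act_mem_geodesicSegment (hT : Preserves T) {p q z : Cn n} (hp : p ∈ ball n)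
    (hq : q ∈ ball n) (h : z ∈ geodesicSegment p q) :
    act T z ∈ geodesicSegment (act T p) (act T q) := by
  refine ⟨act_mem hT h.1, ?_⟩
  rw [beta_act hT hp h.1, beta_act hT h.1 hq, beta_act hT hp hq, h.2]

lemma act_mem_solidTriangle (hT : Preserves T) {a b c z : Cn n} (ha : a ∈ ball n)
    (hb : b ∈ ball n) (hc : c ∈ ball n) (h : z ∈ solidTriangle a b c) :
    act T z ∈ solidTriangle (act T a) (act T b) (act T c) := by
  obtain ⟨w, hw, hz⟩ := h
  exact ⟨act T w, act_mem_geodesicSegment hT hb hc hw, act_mem_geodesicSegment hT ha hw.1 hz⟩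

lemma act_mem_solidTriangle_iff (hT : Preserves T) {a b c z : Cn n} (ha : a ∈ ball n)
    (hb : b ∈ ball n) (hc : c ∈ ball n) (hz : z ∈ ball n) :
    act T z ∈ solidTriangle (act T a) (act T b) (act T c) ↔ z ∈ solidTriangle a b c := by
  refine ⟨fun h => ?_, act_mem_solidTriangle hT ha hb hc⟩
  have := act_mem_solidTriangle hT.symm (act_mem hT ha) (act_mem hT hb) (act_mem hT hc) h
  rwa [act_symm_act hT ha, act_symm_act hT hb, act_symm_act hT hc, act_symm_act hT hz] at this

/-- The Hermitian triple product of three points of the ball, which is the inverse of the product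
of the three kernel entries. -/
def triple (x y z : Cn n) : ℂ := (1 - inner ℂ x y) * (1 - inner ℂ y z) * (1 - inner ℂ z x)

/-- Each automorphy factor meets its own conjugate once in the cyclic product, so only a positive
scalar is left. -/
lemma triple_act (hT : Preserves T) {x y z : Cn n} (hx : x ∈ ball n) (hy : y ∈ ball n)
    (hz : z ∈ ball n) : ∃ r : ℝ, 0 < r ∧ triple x y z = r * triple (act T x) (act T y) (act T z) := by
  have h1 := snd_ne_zero hT hx
  have h2 := snd_ne_zero hT hy
  have h3 := snd_ne_zero hT hz
  refine ⟨Complex.normSq (T (x, 1)).2 * Complex.normSq (T (y, 1)).2 * Complex.normSq (T (z, 1)).2,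
    by simp only [← Complex.normSq_pos] at h1 h2 h3; positivity, ?_⟩
  rw [triple, ← act_inner hT hx hy, ← act_inner hT hy hz, ← act_inner hT hz hx, triple]
  push_cast
  rw [← Complex.mul_conj, ← Complex.mul_conj, ← Complex.mul_conj]
  ring

lemma angularInvariant_eq (x y z : Cn n) : angularInvariant x y z = (triple x y z)⁻¹.arg := by
  simp only [angularInvariant, kernel, triple, one_div, mul_inv]

lemma angularInvariant_act (hT : Preserves T) {x y z : Cn n} (hx : x ∈ ball n) (hy : y ∈ ball n)
    (hz : z ∈ ball n) :
    angularInvariant (act T x) (act T y) (act T z) = angularInvariant x y z := by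
  obtain ⟨r, hr, h⟩ := triple_act hT hx hy hz
  rw [angularInvariant_eq, angularInvariant_eq, h, mul_inv, ← Complex.ofReal_inv,
    Complex.arg_real_mul _ (inv_pos.2 hr)]

end act

/-- By Cauchy–Schwarz. This keeps all arguments in `(-π/2, π/2)` and the logarithms below on their
principal branch. -/
lemma one_sub_inner_re_pos {z w : Cn n} (hz : z ∈ ball n) (hw : w ∈ ball n) :
    0 < (1 - inner ℂ z w : ℂ).re := by
  have h1 := mem_ball_iff.1 hz
  have h2 := mem_ball_iff.1 hw
  have h3 := (Complex.re_le_norm (inner ℂ z w)).trans (norm_inner_le_norm z w)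
  simp only [Complex.sub_re, Complex.one_re]
  nlinarith [norm_nonneg z, norm_nonneg w]

lemma one_sub_inner_ne_zero {z w : Cn n} (hz : z ∈ ball n) (hw : w ∈ ball n) :
    (1 - inner ℂ z w : ℂ) ≠ 0 := fun h => by
  simpa [h] using one_sub_inner_re_pos hz hw

/-! ### Complex reflections -/

/-- The complex reflection of `ℂ^(n+1)` in the form-orthogonal complement of `V`. -/
def reflMap (V X : Cn n × ℂ) : Cn n × ℂ := X - (2 * form X V / form V V) • V

lemma form_reflMap_right {V : Cn n × ℂ} (hV : form V V ≠ 0) (X : Cn n × ℂ) :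
    form (reflMap V X) V = - form X V := by
  rw [reflMap, sub_eq_add_neg, ← neg_smul, form_add_left, form_smul_left]
  field_simp; ring

/-- The complex reflection in `V` as a linear automorphism. -/
def refl (V : Cn n × ℂ) (hV : form V V ≠ 0) : (Cn n × ℂ) ≃ₗ[ℂ] (Cn n × ℂ) :=
  LinearEquiv.ofInvolutive
    { toFun := reflMap V
      map_add' := fun X Y => by
        simp only [reflMap, form_add_left, mul_add, add_div, add_smul]; abel
      map_smul' := fun c X => by
        simp only [reflMap, form_smul_left, smul_sub, smul_smul, RingHom.id_apply]
        congr 2; ring }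
    (fun X => by
      change reflMap V (reflMap V X) = X
      rw [reflMap, form_reflMap_right hV, reflMap, sub_sub, ← add_smul]
      ring_nf
      simp)

lemma refl_apply (V : Cn n × ℂ) (hV : form V V ≠ 0) (X : Cn n × ℂ) :
    refl V hV X = X - (2 * form X V / form V V) • V := rfl

lemma refl_preserves (V : Cn n × ℂ) (hV : form V V ≠ 0) : Preserves (refl V hV) := fun X Y => by
  have h1 : (starRingEnd ℂ) (form V V) = form V V := form_conj V V
  simp only [refl_apply, sub_eq_add_neg, ← neg_smul, form_add_left, form_smul_left, form_add_right,
    form_smul_right, map_neg, map_div₀, map_mul, form_conj, h1, Complex.conj_ofNat]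
  field_simp; ring

/-- The hypotheses make `2 * form X V` equal to `form V V` for `V = X + Y`, so exactly `V` is
subtracted. -/
lemma refl_swap {X Y : Cn n × ℂ} (hV : form (X + Y) (X + Y) ≠ 0) (h1 : form X X = form Y Y)
    (h2 : form X Y = form Y X) : refl (X + Y) hV X = - Y := by
  have h : 2 * form X (X + Y) = form (X + Y) (X + Y) := by
    simp only [form_add_left, form_add_right, h1, h2]; ring
  rw [refl_apply, h, div_self hV]; simp

/-- An involutive automorphism exchanging `0` and `p`, in explicit form. -/
lemma exists_exchange {p : Cn n} (hp : p ∈ ball n) :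
    ∃ (T : (Cn n × ℂ) ≃ₗ[ℂ] (Cn n × ℂ)) (s : ℝ), Preserves T ∧ 0 < s ∧ s ^ 2 = 1 - ‖p‖ ^ 2 ∧
      ∀ z, T (z, 1) = (z, 1) + ((inner ℂ p z - 1 - s) / (s * (1 + s)) : ℂ) • (p, (1 + s : ℂ)) := by
  have h := normSq_lt_one hp
  set s : ℝ := Real.sqrt (1 - ‖p‖ ^ 2) with hs
  have hs0 : 0 < s := Real.sqrt_pos.2 (by linarith)
  have hs2 : s ^ 2 = 1 - ‖p‖ ^ 2 := Real.sq_sqrt (by linarith)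
  have hsC : (s : ℂ) ^ 2 = 1 - (‖p‖ : ℂ) ^ 2 := by exact_mod_cast hs2
  have hsc : (s : ℂ) * (1 + s) ≠ 0 := by
    have : s * (1 + s) ≠ 0 := by positivity
    exact_mod_cast this
  -- The reflection vector is `(p, 1) + (0, s)`. Both summands have form value `-s ^ 2` and their
  -- mutual product is real, so the reflection swaps them up to sign and hence exchanges `p` and
  -- `0`.
  have e : form (p, (1 + s : ℂ)) (p, (1 + s : ℂ)) = -2 * (s * (1 + s)) := by
    simp only [form, inner_self_ofReal, map_add, map_one, Complex.conj_ofReal]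
    push_cast
    linear_combination hsC
  refine ⟨refl (p, (1 + s : ℂ)) (by rw [e]; exact mul_ne_zero (by norm_num) hsc), s,
    refl_preserves _ _, hs0, hs2, fun z => ?_⟩
  have e' : form (z, 1) (p, (1 + s : ℂ)) = inner ℂ p z - 1 - s := by
    simp only [form, map_add, map_one, Complex.conj_ofReal]; ring
  rw [refl_apply, e, e', sub_eq_add_neg, ← neg_smul]
  congr 2
  field_simp

/-- The automorphism group acts transitively on the ball. -/
lemma exists_act_zero {p : Cn n} (hp : p ∈ ball n) :
    ∃ T : (Cn n × ℂ) ≃ₗ[ℂ] (Cn n × ℂ), Preserves T ∧ act T 0 = p := by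
  obtain ⟨T, s, hT, hs, -, h⟩ := exists_exchange hp
  have hsc : (s : ℂ) ≠ 0 := by exact_mod_cast hs.ne'
  have hsc' : (1 + s : ℂ) ≠ 0 := by
    have : 1 + s ≠ 0 := by positivity
    exact_mod_cast this
  refine ⟨T, hT, act_eq_of_lift (c := -(s : ℂ)⁻¹) (by simpa using hsc) ?_⟩
  rw [h]
  ext1
  · simp only [inner_zero_right, Prod.smul_mk, Prod.mk_add_mk, zero_add]
    congr 1
    field_simp
    ring
  · simp only [inner_zero_right, Prod.smul_mk, Prod.mk_add_mk, smul_eq_mul]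
    field_simp
    ring

lemma act_trans {S T : (Cn n × ℂ) ≃ₗ[ℂ] (Cn n × ℂ)} (hS : Preserves S) (hT : Preserves T)
    {z : Cn n} (hz : z ∈ ball n) : act (S.trans T) z = act T (act S z) := by
  refine act_eq_of_lift (mul_ne_zero (snd_ne_zero hS hz) (snd_ne_zero hT (act_mem hS hz))) ?_
  rw [mul_smul, ← lift_act hT (act_mem hS hz), ← map_smul, ← lift_act hS hz]
  rfl

/-! ### Geodesic segments -/

lemma one_sub_mul_norm_le {z w : Cn n} : 1 - ‖z‖ * ‖w‖ ≤ ‖(1 - inner ℂ z w : ℂ)‖ := by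
  have h1 := norm_sub_norm_le (1 : ℂ) (inner ℂ z w)
  have h2 : ‖(inner ℂ z w : ℂ)‖ ≤ _ := norm_inner_le_norm z w
  rw [norm_one] at h1
  linarith

lemma rho_nonneg (z w : Cn n) : 0 ≤ rho z w := Real.sqrt_nonneg _

/-- The content is that the radicand in `rho` is nonnegative: `(1 - |z||w|)² - (1 - |z|²)(1 - |w|²)`
is the square `(|z| - |w|)²`. -/
lemma one_sub_rho_sq {z w : Cn n} (hz : z ∈ ball n) (hw : w ∈ ball n) :
    (1 - rho z w ^ 2) * ‖(1 - inner ℂ z w : ℂ)‖ ^ 2 = (1 - ‖z‖ ^ 2) * (1 - ‖w‖ ^ 2) := by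
  have h0 : 0 < ‖(1 - inner ℂ z w : ℂ)‖ ^ 2 := by
    have := one_sub_inner_ne_zero hz hw
    positivity
  have h1 := mem_ball_iff.1 hz
  have h2 := mem_ball_iff.1 hw
  have h3 := one_sub_mul_norm_le (z := z) (w := w)
  have h4 : ‖z‖ * ‖w‖ < 1 := by nlinarith [norm_nonneg z, norm_nonneg w]
  have h5 : (1 - ‖z‖ ^ 2) * (1 - ‖w‖ ^ 2) ≤ ‖(1 - inner ℂ z w : ℂ)‖ ^ 2 := by
    calc _ ≤ (1 - ‖z‖ * ‖w‖) ^ 2 := by nlinarith [sq_nonneg (‖z‖ - ‖w‖)]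
      _ ≤ _ := pow_le_pow_left₀ (by linarith) h3 2
  rw [rho, Real.sq_sqrt (by rw [sub_nonneg]; exact div_le_one_of_le₀ h5 h0.le),
    sub_sub_cancel, div_mul_cancel₀ _ h0.ne']

lemma rho_lt_one {z w : Cn n} (hz : z ∈ ball n) (hw : w ∈ ball n) : rho z w < 1 := by
  have h := one_sub_rho_sq hz hw
  have h1 := normSq_lt_one hz
  have h2 := normSq_lt_one hw
  have h3 : 0 < (1 - ‖z‖ ^ 2) * (1 - ‖w‖ ^ 2) := mul_pos (by linarith) (by linarith)
  by_contra h4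
  have h5 : 1 - rho z w ^ 2 ≤ 0 := by nlinarith
  nlinarith [mul_nonneg (neg_nonneg.2 h5) (sq_nonneg ‖(1 - inner ℂ z w : ℂ)‖)]

lemma rho_mem {z w : Cn n} (hz : z ∈ ball n) (hw : w ∈ ball n) :
    rho z w ∈ Set.Ioo (-1 : ℝ) 1 :=
  ⟨by linarith [rho_nonneg z w], rho_lt_one hz hw⟩

lemma rho_zero_left (z : Cn n) : rho 0 z = ‖z‖ := by simp [rho]

lemma artanh_add {x y : ℝ} (hx : x ∈ Set.Ico (0 : ℝ) 1) (hy : y ∈ Set.Ico (0 : ℝ) 1) :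
    Real.artanh x + Real.artanh y = Real.artanh ((x + y) / (1 + x * y)) := by
  have hx' : x ∈ Set.Ioo (-1 : ℝ) 1 := ⟨by linarith [hx.1], hx.2⟩
  have hy' : y ∈ Set.Ioo (-1 : ℝ) 1 := ⟨by linarith [hy.1], hy.2⟩
  rw [← Real.artanh_tanh (Real.artanh x + Real.artanh y)]
  congr 1
  have h1 : 0 < √(1 - x ^ 2) := Real.sqrt_pos.2 (by nlinarith [hx.1, hx.2])
  have h2 : 0 < √(1 - y ^ 2) := Real.sqrt_pos.2 (by nlinarith [hy.1, hy.2])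
  have h3 : 0 < 1 + x * y := by nlinarith [hx.1, hy.1]
  rw [Real.tanh_eq_sinh_div_cosh, Real.sinh_add, Real.cosh_add, Real.sinh_artanh hx',
    Real.sinh_artanh hy', Real.cosh_artanh hx', Real.cosh_artanh hy']
  field_simp

/-- Since `rho 0` is the norm, the addition law and injectivity of `artanh` make equality in the
triangle inequality algebraic. -/
lemma beta_add_eq_iff {q z : Cn n} (hq : q ∈ ball n) (hz : z ∈ ball n) :
    beta 0 z + beta z q = beta 0 q ↔ rho z q * (1 - ‖z‖ * ‖q‖) = ‖q‖ - ‖z‖ := by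
  have h1 := mem_ball_iff.1 hz
  have h2 := mem_ball_iff.1 hq
  have h3 := rho_lt_one hz hq
  have h4 := rho_nonneg z q
  have h5 : 0 < 1 + ‖z‖ * rho z q := by positivity
  rw [beta, beta, beta, rho_zero_left, rho_zero_left, artanh_add ⟨norm_nonneg _, h1⟩ ⟨h4, h3⟩,
    Real.artanh_injOn.eq_iff _ ⟨by linarith [norm_nonneg q], h2⟩, div_eq_iff h5.ne']
  · constructor <;> intro h <;> linarith
  · rw [Set.mem_Ioo, lt_div_iff₀ h5, div_lt_one h5]
    constructor <;> nlinarith [norm_nonneg z]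

/-- Inserting the formula for `rho` into the additivity condition gives `|1 - inner z q| = 1 -
|z||q|`. This is equality in Cauchy–Schwarz with a nonnegative real inner product, so `z` is a
nonnegative multiple of `q`. -/
lemma mem_geodesicSegment_zero {q z : Cn n} (hq : q ∈ ball n) :
    z ∈ geodesicSegment 0 q ↔ ∃ t ∈ Set.Icc (0 : ℝ) 1, z = (t : ℂ) • q := by
  have h2 := mem_ball_iff.1 hq
  constructor
  · rintro ⟨hz, h⟩
    rw [beta_add_eq_iff hq hz] at h
    have h1 := mem_ball_iff.1 hz
    have h3 := one_sub_rho_sq hz hq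
    have h4 := rho_nonneg z q
    have h5 : 0 < 1 - ‖z‖ * ‖q‖ := by nlinarith [norm_nonneg z, norm_nonneg q]
    have h6 : ‖z‖ ≤ ‖q‖ := by nlinarith
    have h7 : 0 < 1 - rho z q ^ 2 := by nlinarith [rho_lt_one hz hq]
    have h8 : (1 - rho z q ^ 2) * (1 - ‖z‖ * ‖q‖) ^ 2 = (1 - ‖z‖ ^ 2) * (1 - ‖q‖ ^ 2) := by
      have : rho z q ^ 2 * (1 - ‖z‖ * ‖q‖) ^ 2 = (‖q‖ - ‖z‖) ^ 2 := by rw [← h]; ring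
      linarith
    have h9 : ‖(1 - inner ℂ z q : ℂ)‖ ^ 2 = (1 - ‖z‖ * ‖q‖) ^ 2 :=
      mul_left_cancel₀ h7.ne' (h3.trans h8.symm)
    have h10 : ‖(1 - inner ℂ z q : ℂ)‖ = 1 - ‖z‖ * ‖q‖ :=
      (pow_left_inj₀ (norm_nonneg _) h5.le two_ne_zero).1 h9
    have h11 : ‖z‖ * ‖q‖ ≤ (inner ℂ z q : ℂ).re := by
      have := Complex.re_le_norm (1 - inner ℂ z q : ℂ)
      rw [h10, Complex.sub_re, Complex.one_re] at this
      linarith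
    have h12 : ‖(‖q‖ : ℂ) • z - (‖z‖ : ℂ) • q‖ ^ 2 ≤ 0 := by
      rw [norm_sub_sq (𝕜 := ℂ), inner_smul_left, inner_smul_right, norm_smul, norm_smul,
        Complex.conj_ofReal, ← mul_assoc, ← Complex.ofReal_mul, RCLike.re_to_complex,
        Complex.re_ofReal_mul, Complex.norm_real, Complex.norm_real, norm_norm, norm_norm]
      nlinarith [mul_nonneg (norm_nonneg z) (norm_nonneg q)]
    have h13 : (‖q‖ : ℂ) • z = (‖z‖ : ℂ) • q := by
      rw [← sub_eq_zero, ← norm_eq_zero]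
      exact pow_eq_zero_iff two_ne_zero |>.1 (le_antisymm h12 (sq_nonneg _))
    rcases eq_or_ne q 0 with rfl | hq0
    · refine ⟨0, by simp, ?_⟩
      rw [norm_zero] at h6
      simpa using h6
    · have hq1 : 0 < ‖q‖ := norm_pos_iff.2 hq0
      refine ⟨‖z‖ / ‖q‖, ⟨by positivity, div_le_one_of_le₀ h6 hq1.le⟩, ?_⟩
      have hq2 : (‖q‖ : ℂ) ≠ 0 := by exact_mod_cast hq1.ne'
      rw [Complex.ofReal_div, div_eq_inv_mul, mul_smul, ← h13, smul_smul, inv_mul_cancel₀ hq2,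
        one_smul]
  · rintro ⟨t, ⟨ht0, ht1⟩, rfl⟩
    have hn : ‖(t : ℂ) • q‖ = t * ‖q‖ := by
      rw [norm_smul, Complex.norm_real, Real.norm_of_nonneg ht0]
    have hz : (t : ℂ) • q ∈ ball n := by
      rw [mem_ball_iff, hn]; nlinarith [norm_nonneg q]
    refine ⟨hz, (beta_add_eq_iff hq hz).2 ?_⟩
    have h3 := one_sub_rho_sq hz hq
    have h0 : 0 < 1 - t * ‖q‖ * ‖q‖ := by
      have : ‖q‖ * ‖q‖ < 1 := by nlinarith [norm_nonneg q]
      nlinarith [mul_self_nonneg ‖q‖]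
    have h4 : ‖(1 - inner ℂ ((t : ℂ) • q) q : ℂ)‖ = 1 - t * ‖q‖ * ‖q‖ := by
      rw [inner_smul_left, inner_self_ofReal, Complex.conj_ofReal, ← Complex.ofReal_mul,
        ← Complex.ofReal_one, ← Complex.ofReal_sub, Complex.norm_real, Real.norm_of_nonneg]
      · ring
      · nlinarith
    rw [h4, hn] at h3
    rw [hn]
    refine (pow_left_inj₀ (mul_nonneg (rho_nonneg _ _) h0.le) ?_ two_ne_zero).1 ?_
    · nlinarith [norm_nonneg q]
    · linarith

/-! ### Parametrization of segments -/

/-- Homogeneous coordinate of the point of parameter `t` of the segment from `p` to `q`. -/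
def geoDen (p q : Cn n) (t : ℝ) : ℂ := (1 - t) + t * (1 - inner ℂ q p)

/-- The point of parameter `t` of the geodesic segment from `p` to `q`. -/
def geo (p q : Cn n) (t : ℝ) : Cn n :=
  (geoDen p q t)⁻¹ • ((1 - t : ℂ) • p + ((t : ℂ) * (1 - inner ℂ q p)) • q)

lemma geoDen_ne_zero {p q : Cn n} (hp : p ∈ ball n) (hq : q ∈ ball n) {t : ℝ}
    (ht : t ∈ Set.Icc (0 : ℝ) 1) : geoDen p q t ≠ 0 := fun h => by
  have h1 := one_sub_inner_re_pos hq hp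
  have h2 : (geoDen p q t).re = (1 - t) + t * (1 - inner ℂ q p : ℂ).re := by
    rw [geoDen, Complex.add_re, Complex.re_ofReal_mul]; simp
  rw [h, Complex.zero_re] at h2
  rcases ht.2.eq_or_lt with rfl | ht1
  · linarith
  · nlinarith [ht.1]

/-- In homogeneous coordinates the segment is a real line segment between lifts of `p` and `q`. The
coefficient `1 - inner ℂ q p` is chosen so that the form of these two lifts is real and negative. -/
lemma geo_lift {p q : Cn n} (hp : p ∈ ball n) (hq : q ∈ ball n) {t : ℝ}
    (ht : t ∈ Set.Icc (0 : ℝ) 1) :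
    (1 - t : ℂ) • (p, (1 : ℂ)) + ((t : ℂ) * (1 - inner ℂ q p)) • (q, (1 : ℂ))
      = geoDen p q t • (geo p q t, (1 : ℂ)) := by
  have h := geoDen_ne_zero hp hq ht
  ext1
  · simp [geo, smul_smul, h]
  · simp [geoDen]

lemma geo_zero (p q : Cn n) : geo p q 0 = p := by simp [geo, geoDen]

lemma geo_one {p q : Cn n} (hp : p ∈ ball n) (hq : q ∈ ball n) : geo p q 1 = q := by
  have := one_sub_inner_ne_zero hq hp
  simp [geo, geoDen, smul_smul, this]

lemma geo_zero_left (q : Cn n) (t : ℝ) : geo 0 q t = (t : ℂ) • q := by simp [geo, geoDen]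

/-- Up to a positive reparametrization, an automorphism moving `0` to `p` carries the ray towards
`q'` to the segment from `p` to the image of `q'`. -/
lemma exists_act_ray {T : (Cn n × ℂ) ≃ₗ[ℂ] (Cn n × ℂ)} (hT : Preserves T) {q' : Cn n}
    (hq' : q' ∈ ball n) : ∃ k : ℝ, 0 < k ∧ ∀ t ∈ Set.Icc (0 : ℝ) 1,
      ∀ s ∈ Set.Icc (0 : ℝ) 1, (1 - t) * k * s = t * (1 - s) →
        act T ((s : ℂ) • q') = geo (act T 0) (act T q') t := by
  have h0 := snd_ne_zero hT zero_mem_ball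
  have h1 := snd_ne_zero hT hq'
  have hp := act_mem hT (n := n) zero_mem_ball
  have hq := act_mem hT hq'
  have hI := act_inner hT hq' zero_mem_ball
  rw [inner_zero_right, sub_zero] at hI
  set j := (T (0, 1)).2 with hj
  set j' := (T (q', 1)).2 with hj'
  have hN : 0 < Complex.normSq j' := Complex.normSq_pos.2 h1
  have hμ : (1 - inner ℂ (act T q') (act T 0) : ℂ) * (j * Complex.normSq j') = j' := by
    rw [← Complex.mul_conj]; linear_combination j' * hI
  -- The image of `s • q'` has homogeneous coefficients in the ratio `s j' : (1 - s) j`. By `hμ`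
  -- this is `s |j'|² (1 - inner q p) : (1 - s)`, with `p`, `q` the images of `0`, `q'`; matching it
  -- with `geo` forces `k = |j'|²`.
  refine ⟨Complex.normSq j', hN, fun t ht s hs hts => ?_⟩
  have hz : (s : ℂ) • q' ∈ ball n := ((mem_geodesicSegment_zero hq').2 ⟨s, hs, rfl⟩).1
  have hgd := geoDen_ne_zero hp hq ht
  have e1 : T ((s : ℂ) • q', 1) = ((1 - s) * j) • (act T 0, (1 : ℂ)) +
      (s * j') • (act T q', (1 : ℂ)) := by
    rw [mul_smul, mul_smul, hj, hj', ← lift_act hT zero_mem_ball, ← lift_act hT hq', ← map_smul,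
      ← map_smul, ← map_add]
    simp
  have e2 := geo_lift hp hq ht
  have hts' : (1 - t : ℂ) * Complex.normSq j' * s = t * (1 - s) := by exact_mod_cast hts
  rcases ht.2.eq_or_lt with rfl | ht1
  · have hs1 : s = 1 := by linarith
    subst hs1
    rw [geo_one hp hq]; simp
  · have ht2 : (1 - t : ℂ) ≠ 0 := by
      have : (1 - t : ℝ) ≠ 0 := by linarith
      exact_mod_cast this
    refine act_eq_of_lift (c := (1 - s) * j / (1 - t) * geoDen (act T 0) (act T q') t) ?_ ?_
    · refine mul_ne_zero (div_ne_zero (mul_ne_zero ?_ h0) ht2) hgd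
      have hs1 : s ≠ 1 := by
        rintro rfl
        have : (1 - t) * Complex.normSq j' ≠ 0 := mul_ne_zero (by linarith) hN.ne'
        apply this; linarith
      have : (1 - s : ℝ) ≠ 0 := fun h => hs1 (by linarith)
      exact_mod_cast this
    · rw [mul_smul, ← e2, e1, smul_add, smul_smul, smul_smul]
      congr 2
      · field_simp
      · field_simp
        linear_combination ((1 - inner ℂ (act T q') (act T 0) : ℂ) * j) * hts'
          - s * (1 - t) * hμ

/-- Transport from the origin, where segments are Euclidean. Solving `(1 - t) k s = t (1 - s)` for
either variable gives the two fractional linear parameter changes of `[0, 1]`. -/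
lemma mem_geodesicSegment_iff {p q z : Cn n} (hp : p ∈ ball n) (hq : q ∈ ball n) :
    z ∈ geodesicSegment p q ↔ ∃ t ∈ Set.Icc (0 : ℝ) 1, z = geo p q t := by
  obtain ⟨T, hT, rfl⟩ := exists_act_zero hp
  obtain ⟨q', hq', rfl⟩ : ∃ q' ∈ ball n, act T q' = q :=
    ⟨act T.symm q, act_mem hT.symm hq, act_act_symm hT hq⟩
  obtain ⟨k, hk, H⟩ := exists_act_ray hT hq'
  constructor
  · intro hz
    have h1 := act_mem_geodesicSegment hT.symm hp hq hz
    rw [act_symm_act hT zero_mem_ball, act_symm_act hT hq', mem_geodesicSegment_zero hq'] at h1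
    obtain ⟨s, hs, h⟩ := h1
    have hd : 0 < (1 - s) + k * s := by
      rcases hs.2.eq_or_lt with rfl | hs1
      · linarith
      · nlinarith [hs.1, mul_nonneg hk.le hs.1]
    have ht : k * s / ((1 - s) + k * s) ∈ Set.Icc (0 : ℝ) 1 :=
      ⟨div_nonneg (mul_nonneg hk.le hs.1) hd.le,
        div_le_one_of_le₀ (by linarith [hs.2]) hd.le⟩
    refine ⟨_, ht, ?_⟩
    rw [← H _ ht s hs (by field_simp; ring), ← h, act_act_symm hT hz.1]
  · rintro ⟨t, ht, rfl⟩
    have hd : 0 < t + k * (1 - t) := by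
      rcases ht.2.eq_or_lt with rfl | hs1
      · linarith
      · nlinarith [ht.1, mul_pos hk (sub_pos.2 hs1)]
    have hs : t / (t + k * (1 - t)) ∈ Set.Icc (0 : ℝ) 1 :=
      ⟨div_nonneg ht.1 hd.le,
        div_le_one_of_le₀ (by linarith [mul_nonneg hk.le (sub_nonneg.2 ht.2)]) hd.le⟩
    rw [← H t ht _ hs (by linear_combination div_mul_cancel₀ t hd.ne')]
    exact act_mem_geodesicSegment hT zero_mem_ball hq'
      ((mem_geodesicSegment_zero hq').2 ⟨_, hs, rfl⟩)

lemma geo_mem_geodesicSegment {p q : Cn n} (hp : p ∈ ball n) (hq : q ∈ ball n) {t : ℝ}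
    (ht : t ∈ Set.Icc (0 : ℝ) 1) : geo p q t ∈ geodesicSegment p q :=
  (mem_geodesicSegment_iff hp hq).2 ⟨t, ht, rfl⟩

lemma left_mem_geodesicSegment {p q : Cn n} (hp : p ∈ ball n) (hq : q ∈ ball n) :
    p ∈ geodesicSegment p q := by
  simpa [geo_zero] using geo_mem_geodesicSegment hp hq (t := 0) (by simp)

lemma right_mem_geodesicSegment {p q : Cn n} (hp : p ∈ ball n) (hq : q ∈ ball n) :
    q ∈ geodesicSegment p q := by
  simpa [geo_one hp hq] using geo_mem_geodesicSegment hp hq (t := 1) (by simp)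

/-- Triples formed by an endpoint and two points of a geodesic segment have angular invariant
zero. -/
lemma geodesicSegment_im_eq_zero {p q z w : Cn n} (hp : p ∈ ball n) (hq : q ∈ ball n)
    (hz : z ∈ geodesicSegment p q) (hw : w ∈ geodesicSegment p q) :
    (triple z w p).im = 0 := by
  obtain ⟨T, hT, rfl⟩ := exists_act_zero hp
  have hz' := act_mem_geodesicSegment hT.symm hp hq hz
  have hw' := act_mem_geodesicSegment hT.symm hp hq hw
  rw [act_symm_act hT zero_mem_ball, mem_geodesicSegment_zero (act_mem hT.symm hq)] at hz' hw'
  obtain ⟨s, -, hs⟩ := hz'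
  obtain ⟨t, -, ht⟩ := hw'
  obtain ⟨r, -, h⟩ := triple_act hT.symm hz.1 hw.1 hp
  -- With `p` at the origin, `z` and `w` are real multiples of one vector and the only nontrivial
  -- factor is real.
  rw [h, act_symm_act hT zero_mem_ball, hs, ht, Complex.im_ofReal_mul]
  simp only [triple, inner_zero_left, inner_zero_right, mul_zero, sub_zero, mul_one, inner_smul_left,
    inner_smul_right, inner_self_ofReal, Complex.conj_ofReal]
  rw [← Complex.ofReal_mul, ← Complex.ofReal_mul, ← Complex.ofReal_one, ← Complex.ofReal_sub,
    Complex.ofReal_im, mul_zero]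

/-- The triple product of three points of the ball has positive real part. -/
lemma triple_re_pos {x y z : Cn n} (hx : x ∈ ball n) (hy : y ∈ ball n) (hz : z ∈ ball n) :
    0 < (triple x y z).re := by
  obtain ⟨T, hT, rfl⟩ := exists_act_zero hx
  obtain ⟨r, hr, h⟩ := triple_act hT.symm hx hy hz
  rw [h, act_symm_act hT zero_mem_ball, Complex.re_ofReal_mul]
  refine mul_pos hr ?_
  simpa [triple] using one_sub_inner_re_pos (act_mem hT.symm hy) (act_mem hT.symm hz)

/-! ### A primitive of the symplectic form and Stokes' theorem on the square -/

/-- A primitive of the symplectic form. -/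
def eta (z u : Cn n) : ℝ := 2 * (inner ℂ z u).im / (1 - ‖z‖ ^ 2)

lemma eta_continuousOn {X : Type*} [TopologicalSpace X] {s : Set X} {σ v : X → Cn n}
    (hσ : ContinuousOn σ s) (hv : ContinuousOn v s) (hb : ∀ x ∈ s, σ x ∈ ball n) :
    ContinuousOn (fun x => eta (σ x) (v x)) s := by
  unfold eta
  refine ContinuousOn.div (continuousOn_const.mul
    (Complex.continuous_im.comp_continuousOn (hσ.inner hv))) (by fun_prop) fun x hx => ?_
  have := normSq_lt_one (hb x hx)
  linarith

lemma omega_continuousOn {X : Type*} [TopologicalSpace X] {s : Set X} {σ u v : X → Cn n}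
    (hσ : ContinuousOn σ s) (hu : ContinuousOn u s) (hv : ContinuousOn v s)
    (hb : ∀ x ∈ s, σ x ∈ ball n) :
    ContinuousOn (fun x => omega (σ x) (u x) (v x)) s := by
  unfold omega
  refine ContinuousOn.div (continuousOn_const.mul
    (Complex.continuous_im.comp_continuousOn
      (((Complex.continuous_ofReal.comp_continuousOn (by fun_prop)).mul (hu.inner hv)).add
        ((hu.inner hσ).mul (hσ.inner hv))))) (by fun_prop) fun x hx => ?_
  have := normSq_lt_one (hb x hx)
  have : 0 < 1 - ‖σ x‖ ^ 2 := by linarith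
  positivity

/-- The vector argument is a separate map `v`, later a partial derivative of `σ`, so that second
derivatives of the surface enter only through `B`. -/
lemma hasFDerivAt_eta {E : Type*} [NormedAddCommGroup E] [NormedSpace ℝ E] {σ v : E → Cn n}
    {A B : E →L[ℝ] Cn n} {p : E} (hσ : HasFDerivAt σ A p) (hv : HasFDerivAt v B p)
    (hb : σ p ∈ ball n) :
    ∃ L : E →L[ℝ] ℝ, HasFDerivAt (fun x => eta (σ x) (v x)) L p ∧
      ∀ w, L w = 2 * ((1 - ‖σ p‖ ^ 2) * ((inner ℂ (A w) (v p)).im + (inner ℂ (σ p) (B w)).im)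
        + 2 * (inner ℂ (σ p) (v p)).im * (inner ℂ (σ p) (A w)).re) / (1 - ‖σ p‖ ^ 2) ^ 2 := by
  have h1 := Complex.imCLM.hasFDerivAt.comp p (hσ.inner ℂ hv)
  have h2 := Complex.reCLM.hasFDerivAt.comp p (hσ.inner ℂ hσ)
  have hn : ∀ z : Cn n, ‖z‖ ^ 2 = (inner ℂ z z : ℂ).re := fun z => by
    rw [inner_self_ofReal, Complex.ofReal_re]
  have hpos : 1 - ‖σ p‖ ^ 2 ≠ 0 := by
    have := normSq_lt_one hb
    linarith
  have hpos' : (1 : ℝ) - (inner ℂ (σ p) (σ p) : ℂ).re ≠ 0 := by rwa [← hn]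
  have h3 := (h1.const_mul 2).mul ((hasDerivAt_inv hpos').comp_hasFDerivAt p
    ((hasFDerivAt_const (1 : ℝ) p).sub h2))
  refine ⟨_, h3.congr_of_eventuallyEq (.of_forall fun x => ?_), fun w => ?_⟩
  · change eta (σ x) (v x) =
      2 * (inner ℂ (σ x) (v x) : ℂ).im * (1 - (inner ℂ (σ x) (σ x) : ℂ).re)⁻¹
    rw [← hn, eta, div_eq_mul_inv]
  · have hre : (inner ℂ (A w) (σ p) : ℂ).re = (inner ℂ (σ p) (A w) : ℂ).re := by
      rw [← inner_conj_symm, Complex.conj_re]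
    simp [fderivInnerCLM_apply, ← hn, hre, -inner_self_eq_norm_sq_to_K]
    field_simp
    ring

/-- The integral of the primitive along a path in a geodesic segment. -/
lemma integral_eta_segment {p q : Cn n} (hp : p ∈ ball n) (hq : q ∈ ball n) {γ γ' : ℝ → Cn n}
    (hγ : ∀ s ∈ Set.Icc (0 : ℝ) 1, HasDerivWithinAt γ (γ' s) (Set.Icc 0 1) s)
    (hγ' : ContinuousOn γ' (Set.Icc 0 1))
    (hs : ∀ s ∈ Set.Icc (0 : ℝ) 1, γ s ∈ geodesicSegment p q) (h0 : γ 0 = p) (h1 : γ 1 = q) :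
    ∫ s in (0 : ℝ)..1, eta (γ s) (γ' s) = -2 * (1 - inner ℂ p q : ℂ).arg := by
  have hc : ContinuousOn γ (Set.Icc 0 1) := fun s hs => (hγ s hs).continuousWithinAt
  have hsl : ∀ s ∈ Set.Icc (0 : ℝ) 1, (1 - inner ℂ p (γ s) : ℂ) ∈ Complex.slitPlane :=
    fun s h => Or.inl (one_sub_inner_re_pos hp (hs s h).1)
  have hlog : ContinuousOn (fun s => -2 * (Complex.log (1 - inner ℂ p (γ s))).im)
      (Set.Icc (0 : ℝ) 1) :=
    continuousOn_const.mul (Complex.continuous_im.comp_continuousOn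
      (ContinuousOn.clog (continuousOn_const.sub (continuousOn_const.inner hc)) hsl))
  have key := intervalIntegral.integral_eq_sub_of_hasDerivAt_of_le zero_le_one hlog
    (f' := fun s => eta (γ s) (γ' s)) (fun s hs' => ?_) ?_
  · rw [key, h0, h1, Complex.log_im, Complex.log_im, inner_self_ofReal]
    have : (1 - ((‖p‖ ^ 2 : ℝ) : ℂ)).arg = 0 := by
      rw [← Complex.ofReal_one, ← Complex.ofReal_sub]
      exact Complex.arg_ofReal_of_nonneg (by linarith [normSq_lt_one hp])
    rw [this]; ring
  · have hI := Set.Ioo_subset_Icc_self hs'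
    have hd : HasDerivAt γ (γ' s) s := (hγ s hI).hasDerivAt (Icc_mem_nhds hs'.1 hs'.2)
    have hin : ∀ x : Cn n, HasDerivAt (fun r => (1 - inner ℂ x (γ r) : ℂ)) (-inner ℂ x (γ' s)) s :=
      fun x => by
        exact ((hasDerivAt_const s (1 : ℂ)).sub ((hasDerivAt_const s x).inner ℂ hd)).congr_deriv
          (by simp)
    have hin' : ∀ x : Cn n, HasDerivAt (fun r => (1 - inner ℂ (γ r) x : ℂ)) (-inner ℂ (γ' s) x) s :=
      fun x => by
        exact ((hasDerivAt_const s (1 : ℂ)).sub (hd.inner ℂ (hasDerivAt_const s x))).congr_deriv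
          (by simp)
    have hL := (Complex.imCLM.hasFDerivAt.comp_hasDerivAt s
      ((hin p).clog_real (hsl s hI))).const_mul (-2)
    refine hL.congr_deriv ?_
    -- Fix `γ s` and vary the second point of the triple. The imaginary part is identically zero
    -- near `r = s`, and its derivative there, where the first factor is the real number `1 - |γ
    -- s|²`, is the identity wanted for `eta`.
    have hz : HasDerivAt (fun r => (triple (γ s) (γ r) p).im) 0 s := by
      have : (fun r => (triple (γ s) (γ r) p).im) =ᶠ[nhds s] fun _ => 0 := by
        filter_upwards [Icc_mem_nhds hs'.1 hs'.2] with r hr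
        exact geodesicSegment_im_eq_zero hp hq (hs s hI) (hs r hr)
      exact (hasDerivAt_const s (0 : ℝ)).congr_of_eventuallyEq this
    have hz' := Complex.imCLM.hasFDerivAt.comp_hasDerivAt s
      (((hin (γ s)).mul (hin' p)).mul (hasDerivAt_const s (1 - inner ℂ p (γ s) : ℂ)))
    have hu := hz.unique hz'
    have hne := Complex.slitPlane_ne_zero (hsl s hI)
    set H : ℂ := 1 - inner ℂ p (γ s) with hH
    have hHc : (1 - inner ℂ (γ s) p : ℂ) = (starRingEnd ℂ) H := by simp [hH, inner_conj_symm]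
    rw [hHc, inner_self_ofReal] at hu
    have hcr : (inner ℂ (γ' s) p : ℂ).re = (inner ℂ p (γ' s) : ℂ).re := by
      rw [← inner_conj_symm, Complex.conj_re]
    have hci : (inner ℂ (γ' s) p : ℂ).im = -(inner ℂ p (γ' s) : ℂ).im := by
      rw [← inner_conj_symm, Complex.conj_im]
    have hpos : (0 : ℝ) < 1 - ‖γ s‖ ^ 2 := by linarith [normSq_lt_one (hs s hI).1]
    have hN := Complex.normSq_pos.2 hne
    rw [Complex.imCLM_apply, Complex.div_im, eta]
    have hN' : Complex.normSq H = H.re * H.re + H.im * H.im := Complex.normSq_apply H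
    simp at hu
    norm_cast at hu
    simp [hcr, hci] at hu ⊢
    field_simp
    rw [hN']
    linear_combination -hu
  · refine ContinuousOn.intervalIntegrable ?_
    rw [Set.uIcc_of_le zero_le_one]
    exact eta_continuousOn hc hγ' fun s h => (hs s h).1

lemma square_eq_Icc : square = Set.Icc ((0 : ℝ), (0 : ℝ)) (1, 1) := by
  rw [Set.Icc_prod_eq]; rfl

lemma uniqueDiffOn_square : UniqueDiffOn ℝ square :=
  (uniqueDiffOn_Icc zero_lt_one).prod (uniqueDiffOn_Icc zero_lt_one)

lemma isCompact_square : IsCompact square := isCompact_Icc.prod isCompact_Icc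

/-- The open unit square. -/
def openSquare : Set (ℝ × ℝ) := Set.Ioo 0 1 ×ˢ Set.Ioo 0 1

lemma isOpen_openSquare : IsOpen openSquare := isOpen_Ioo.prod isOpen_Ioo

lemma openSquare_subset : openSquare ⊆ square :=
  Set.prod_mono Set.Ioo_subset_Icc_self Set.Ioo_subset_Icc_self

lemma openSquare_ae_eq : openSquare =ᵐ[MeasureTheory.volume] square :=
  MeasureTheory.Measure.set_prod_ae_eq MeasureTheory.Ioo_ae_eq_Icc MeasureTheory.Ioo_ae_eq_Icc

lemma square_mem_nhds {p : ℝ × ℝ} (hp : p ∈ openSquare) : square ∈ nhds p :=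
  Filter.mem_of_superset (isOpen_openSquare.mem_nhds hp) openSquare_subset

lemma integrableOn_omega {σ : ℝ × ℝ → Cn n} (hσ : ContDiffOn ℝ ∞ σ square)
    (hb : ∀ p ∈ square, σ p ∈ ball n) :
    MeasureTheory.IntegrableOn (fun p => omega (σ p) (fderivWithin ℝ σ square p (1, 0))
      (fderivWithin ℝ σ square p (0, 1))) square := by
  have hDc : ContinuousOn (fderivWithin ℝ σ square) square :=
    hσ.continuousOn_fderivWithin uniqueDiffOn_square (by simp)
  exact (omega_continuousOn hσ.continuousOn (hDc.clm_apply continuousOn_const)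
    (hDc.clm_apply continuousOn_const) hb).integrableOn_compact isCompact_square

/-- Stokes' theorem for the symplectic form on a smooth square. -/
lemma integralOmega_eq_boundary {σ : ℝ × ℝ → Cn n} (hσ : ContDiffOn ℝ ∞ σ square)
    (hb : ∀ p ∈ square, σ p ∈ ball n) :
    integralOmega σ =
      ((-(∫ s in (0 : ℝ)..1, eta (σ (s, 1)) (fderivWithin ℝ σ square (s, 1) (1, 0)))
        + ∫ s in (0 : ℝ)..1, eta (σ (s, 0)) (fderivWithin ℝ σ square (s, 0) (1, 0)))
        + ∫ t in (0 : ℝ)..1, eta (σ (1, t)) (fderivWithin ℝ σ square (1, t) (0, 1)))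
        - ∫ t in (0 : ℝ)..1, eta (σ (0, t)) (fderivWithin ℝ σ square (0, t) (0, 1)) := by
  set D := fderivWithin ℝ σ square with hD
  have hDc : ContinuousOn D square :=
    hσ.continuousOn_fderivWithin uniqueDiffOn_square (by simp)
  have hDv : ∀ v, ContinuousOn (fun p => D p v) square := fun v =>
    hDc.clm_apply continuousOn_const
  have hη : ∀ v, ContinuousOn (fun p => eta (σ p) (D p v)) square := fun v =>
    eta_continuousOn hσ.continuousOn (hDv v) hb
  have hder : ∀ p ∈ openSquare, ∃ D2 : ℝ × ℝ →L[ℝ] ℝ × ℝ →L[ℝ] Cn n, HasFDerivAt D D2 p ∧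
      HasFDerivAt σ (D p) p ∧ ∀ u v, D2 u v = D2 v u := fun p hp => by
    have hc : ContDiffAt ℝ 2 σ p := (hσ.contDiffAt (square_mem_nhds hp)).of_le
      (WithTop.coe_le_coe.2 le_top)
    -- Derivatives within the square are full derivatives in the interior, where the second
    -- derivative is symmetric.
    have hDe : D =ᶠ[nhds p] fderiv ℝ σ := by
      filter_upwards [isOpen_openSquare.mem_nhds hp] with x hx
      exact fderivWithin_of_mem_nhds (square_mem_nhds hx)
    have hd2 : DifferentiableAt ℝ (fderiv ℝ σ) p :=
      (hc.fderiv_right (m := 1) (by norm_num)).differentiableAt (by simp)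
    refine ⟨fderiv ℝ (fderiv ℝ σ) p, hd2.hasFDerivAt.congr_of_eventuallyEq hDe, ?_, ?_⟩
    · rw [hDe.eq_of_nhds]
      exact (hc.differentiableAt (by simp)).hasFDerivAt
    · exact (hc.isSymmSndFDerivAt (by simp)).eq
  have hη' : ∀ v, ∀ p ∈ openSquare, DifferentiableAt ℝ (fun p => eta (σ p) (D p v)) p :=
    fun v p hp => by
      obtain ⟨D2, h1, h2, -⟩ := hder p hp
      obtain ⟨L, hL, -⟩ := hasFDerivAt_eta h2 (h1.clm_apply (hasFDerivAt_const v p))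
        (hb p (openSquare_subset hp))
      exact hL.differentiableAt
  -- This is `dη = ω` pulled back by `σ`: the second derivatives cancel by symmetry.
  have hdiv : ∀ p ∈ openSquare, fderiv ℝ (fun p => eta (σ p) (D p (0, 1))) p (1, 0)
      + (-fderiv ℝ (fun p => eta (σ p) (D p (1, 0))) p) (0, 1)
      = omega (σ p) (D p (1, 0)) (D p (0, 1)) := fun p hp => by
    obtain ⟨D2, h1, h2, h3⟩ := hder p hp
    have hbp := hb p (openSquare_subset hp)
    obtain ⟨L, hL, hLw⟩ := hasFDerivAt_eta h2 (h1.clm_apply (hasFDerivAt_const (0, 1) p)) hbp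
    obtain ⟨M, hM, hMw⟩ := hasFDerivAt_eta h2 (h1.clm_apply (hasFDerivAt_const (1, 0) p)) hbp
    rw [hL.fderiv, hM.fderiv, neg_apply, hLw, hMw, omega]
    have hsymm := h3 (1, 0) (0, 1)
    have e1 : (inner ℂ (D p (0, 1)) (D p (1, 0)) : ℂ).im
        = -(inner ℂ (D p (1, 0)) (D p (0, 1)) : ℂ).im := by
      rw [← inner_conj_symm, Complex.conj_im]
    have e2 : (inner ℂ (D p (1, 0)) (σ p) : ℂ).re = (inner ℂ (σ p) (D p (1, 0)) : ℂ).re := by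
      rw [← inner_conj_symm, Complex.conj_re]
    have e3 : (inner ℂ (D p (1, 0)) (σ p) : ℂ).im = -(inner ℂ (σ p) (D p (1, 0)) : ℂ).im := by
      rw [← inner_conj_symm, Complex.conj_im]
    rw [Complex.add_im, Complex.mul_im, Complex.mul_im, Complex.ofReal_re, Complex.ofReal_im, e1,
      e2, e3]
    simp only [add_apply, ContinuousLinearMap.comp_apply,
      ContinuousLinearMap.flip_apply, zero_apply, map_zero, zero_add, hsymm]
    ring
  have hint := integrableOn_omega hσ hb
  -- The divergence theorem for the field `(η(∂ₜσ), -η(∂ₛσ))` is Green's formula; differentiability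
  -- is needed only in the open square.
  have hS := MeasureTheory.integral_divergence_prod_Icc_of_hasFDerivAt_of_le
    (fun p => eta (σ p) (D p (0, 1))) (fun p => -eta (σ p) (D p (1, 0)))
    (fun p => fderiv ℝ (fun p => eta (σ p) (D p (0, 1))) p)
    (fun p => -fderiv ℝ (fun p => eta (σ p) (D p (1, 0))) p) (0, 0) (1, 1) (by simp)
    (square_eq_Icc ▸ hη _) (square_eq_Icc ▸ (hη _).neg)
    (fun p hp => (hη' _ p hp).hasFDerivAt) (fun p hp => (hη' _ p hp).hasFDerivAt.neg) ?_
  · rw [← square_eq_Icc, ← MeasureTheory.setIntegral_congr_set openSquare_ae_eq,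
      MeasureTheory.setIntegral_congr_fun isOpen_openSquare.measurableSet hdiv,
      MeasureTheory.setIntegral_congr_set openSquare_ae_eq] at hS
    rw [integralOmega, hS]
    simp only [intervalIntegral.integral_neg]
    ring
  · rw [← square_eq_Icc, ← MeasureTheory.integrableOn_congr_set_ae openSquare_ae_eq]
    exact (hint.mono_set openSquare_subset).congr_fun (fun p hp => (hdiv p hp).symm)
      isOpen_openSquare.measurableSet

/-! ### Arguments of triple products and the value of the symplectic area -/

lemma arg_one_sub_inner_swap {p q : Cn n} (hp : p ∈ ball n) (hq : q ∈ ball n) :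
    (1 - inner ℂ q p : ℂ).arg = -(1 - inner ℂ p q : ℂ).arg := by
  have h : (1 - inner ℂ q p : ℂ) = (starRingEnd ℂ) (1 - inner ℂ p q) := by
    simp [inner_conj_symm]
  rw [h, Complex.arg_conj, if_neg]
  intro h1
  have := Complex.abs_arg_lt_pi_div_two_iff.2 (Or.inl (one_sub_inner_re_pos hp hq))
  rw [h1, abs_of_pos Real.pi_pos] at this
  linarith [Real.pi_pos]

/-- Equality holds modulo `2π`. Three arguments below `π/2` in absolute value, against one such
argument of the product, leave a discrepancy smaller than `2π`. -/
lemma arg_triple {a b c : Cn n} (ha : a ∈ ball n) (hb : b ∈ ball n) (hc : c ∈ ball n) :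
    (triple a b c).arg = (1 - inner ℂ a b : ℂ).arg + (1 - inner ℂ b c : ℂ).arg
      + (1 - inner ℂ c a : ℂ).arg := by
  have h1 := Complex.abs_arg_lt_pi_div_two_iff.2 (Or.inl (one_sub_inner_re_pos ha hb))
  have h2 := Complex.abs_arg_lt_pi_div_two_iff.2 (Or.inl (one_sub_inner_re_pos hb hc))
  have h3 := Complex.abs_arg_lt_pi_div_two_iff.2 (Or.inl (one_sub_inner_re_pos hc ha))
  have h4 := Complex.abs_arg_lt_pi_div_two_iff.2 (Or.inl (triple_re_pos ha hb hc))
  have n1 := one_sub_inner_ne_zero ha hb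
  have n2 := one_sub_inner_ne_zero hb hc
  have n3 := one_sub_inner_ne_zero hc ha
  have h5 : ((triple a b c).arg : Real.Angle) = (((1 - inner ℂ a b : ℂ).arg
      + (1 - inner ℂ b c : ℂ).arg + (1 - inner ℂ c a : ℂ).arg : ℝ) : Real.Angle) := by
    rw [triple, Complex.arg_mul_coe_angle (mul_ne_zero n1 n2) n3, Complex.arg_mul_coe_angle n1 n2]
    rfl
  obtain ⟨k, hk⟩ := Real.Angle.angle_eq_iff_two_pi_dvd_sub.1 h5
  rw [abs_lt] at h1 h2 h3 h4
  have hpi := Real.pi_pos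
  have hk1 : (k : ℝ) < 1 := by
    by_contra h; nlinarith
  have hk2 : (-1 : ℝ) < k := by
    by_contra h; nlinarith
  have hk0 : k = 0 := by
    have a1 : k < 1 := by exact_mod_cast hk1
    have a2 : -1 < k := by exact_mod_cast hk2
    omega
  rw [hk0] at hk
  push_cast at hk
  linarith

lemma angularInvariant_eq_neg_arg {a b c : Cn n} (ha : a ∈ ball n) (hb : b ∈ ball n)
    (hc : c ∈ ball n) : angularInvariant a b c = -(triple a b c).arg := by
  rw [angularInvariant_eq, Complex.arg_inv, if_neg]
  intro h
  have := Complex.abs_arg_lt_pi_div_two_iff.2 (Or.inl (triple_re_pos ha hb hc))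
  rw [h, abs_of_pos Real.pi_pos] at this
  linarith [Real.pi_pos]

/-- The boundary integrals depend only on the vertices, which is why the choice of surface does not
matter. The side `ac` is traversed backwards, hence the swap of `a` and `c`. -/
lemma IsSpanningSurface.integralOmega_eq {a b c : Cn n} (ha : a ∈ ball n) (hb : b ∈ ball n)
    (hc : c ∈ ball n) {σ : ℝ × ℝ → Cn n} (hσ : IsSpanningSurface a b c σ) :
    integralOmega σ = 2 * angularInvariant a b c := by
  have hd : ∀ p ∈ square, HasFDerivWithinAt σ (fderivWithin ℝ σ square p) square p :=
    fun p hp => (hσ.smooth.differentiableOn (by simp) p hp).hasFDerivWithinAt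
  have hDc : ContinuousOn (fderivWithin ℝ σ square) square :=
    hσ.smooth.continuousOn_fderivWithin uniqueDiffOn_square (by simp)
  have hor : ∀ t ∈ Set.Icc (0 : ℝ) 1, (∀ s ∈ Set.Icc (0 : ℝ) 1,
      HasDerivWithinAt (fun s => σ (s, t)) (fderivWithin ℝ σ square (s, t) (1, 0))
        (Set.Icc 0 1) s) ∧
      ContinuousOn (fun s => fderivWithin ℝ σ square (s, t) (1, 0)) (Set.Icc 0 1) := by
    refine fun t ht => ⟨fun s hs => ?_, ?_⟩
    · exact (hd (s, t) ⟨hs, ht⟩).comp_hasDerivWithinAt (f := fun x : ℝ => (x, t))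
        (s := Set.Icc 0 1) s
        ((hasDerivAt_id s).prodMk (hasDerivAt_const s t)).hasDerivWithinAt
        (fun x hx => ⟨hx, ht⟩)
    · exact (hDc.comp (f := fun s : ℝ => (s, t)) (s := Set.Icc 0 1) (by fun_prop)
        (fun x hx => ⟨hx, ht⟩)).clm_apply
        continuousOn_const
  have ver : ∀ s ∈ Set.Icc (0 : ℝ) 1, (∀ t ∈ Set.Icc (0 : ℝ) 1,
      HasDerivWithinAt (fun t => σ (s, t)) (fderivWithin ℝ σ square (s, t) (0, 1))
        (Set.Icc 0 1) t) ∧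
      ContinuousOn (fun t => fderivWithin ℝ σ square (s, t) (0, 1)) (Set.Icc 0 1) := by
    refine fun s hs => ⟨fun t ht => ?_, ?_⟩
    · exact (hd (s, t) ⟨hs, ht⟩).comp_hasDerivWithinAt (f := fun x : ℝ => (s, x))
        (s := Set.Icc 0 1) t
        ((hasDerivAt_const t s).prodMk (hasDerivAt_id t)).hasDerivWithinAt
        (fun x hx => ⟨hs, hx⟩)
    · exact (hDc.comp (f := fun t : ℝ => (s, t)) (s := Set.Icc 0 1) (by fun_prop)
        (fun x hx => ⟨hs, hx⟩)).clm_apply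
        continuousOn_const
  have m0 : (0 : ℝ) ∈ Set.Icc (0 : ℝ) 1 := by simp
  have m1 : (1 : ℝ) ∈ Set.Icc (0 : ℝ) 1 := by simp
  -- The collapsed edge is a constant path, with zero velocity.
  have hv0 : ∫ t in (0 : ℝ)..1, eta (σ (0, t)) (fderivWithin ℝ σ square (0, t) (0, 1)) = 0 := by
    rw [intervalIntegral.integral_congr (g := fun _ => (0 : ℝ)), intervalIntegral.integral_zero]
    intro t ht
    rw [Set.uIcc_of_le zero_le_one] at ht
    have h1 := (ver 0 m0).1 t ht
    have h2 : HasDerivWithinAt (fun t => σ (0, t)) 0 (Set.Icc 0 1) t :=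
      (hasDerivWithinAt_const t _ a).congr hσ.vertex_a (hσ.vertex_a t ht)
    have h3 := (uniqueDiffOn_Icc zero_lt_one t ht).eq_deriv _ h1 h2
    simp [h3, eta]
  rw [integralOmega_eq_boundary hσ.smooth hσ.mem_ball, hv0,
    integral_eta_segment ha hc (hor 1 m1).1 (hor 1 m1).2 hσ.side_ac (hσ.vertex_a 1 m1) hσ.vertex_c,
    integral_eta_segment ha hb (hor 0 m0).1 (hor 0 m0).2 hσ.side_ab (hσ.vertex_a 0 m0) hσ.vertex_b,
    integral_eta_segment hb hc (ver 1 m1).1 (ver 1 m1).2 hσ.side_bc hσ.vertex_b hσ.vertex_c,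
    angularInvariant_eq_neg_arg ha hb hc, arg_triple ha hb hc, arg_one_sub_inner_swap ha hc]
  ring

/-- Endpoints may vary as well as the parameter, so that the lemma can be iterated for the geodesic
cone. -/
lemma contDiffOn_geo {X : Type*} [NormedAddCommGroup X] [NormedSpace ℝ X] {s : Set X}
    {p q : X → Cn n} {t : X → ℝ} (hp : ContDiffOn ℝ ∞ p s) (hq : ContDiffOn ℝ ∞ q s)
    (ht : ContDiffOn ℝ ∞ t s) (hpb : ∀ x ∈ s, p x ∈ ball n) (hqb : ∀ x ∈ s, q x ∈ ball n)
    (htI : ∀ x ∈ s, t x ∈ Set.Icc (0 : ℝ) 1) :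
    ContDiffOn ℝ ∞ (fun x => geo (p x) (q x) (t x)) s := by
  have htc : ContDiffOn ℝ ∞ (fun x => (t x : ℂ)) s := Complex.ofRealCLM.contDiff.comp_contDiffOn ht
  have hi : ContDiffOn ℝ ∞ (fun x => (1 - inner ℂ (q x) (p x) : ℂ)) s :=
    contDiffOn_const.sub (hq.inner ℂ hp)
  unfold geo
  refine ContDiffOn.smul (ContDiffOn.inv ?_ fun x hx =>
    geoDen_ne_zero (hpb x hx) (hqb x hx) (htI x hx)) ?_
  · exact (contDiffOn_const.sub htc).add (htc.mul hi)
  · exact ((contDiffOn_const.sub htc).smul hp).add ((htc.mul hi).smul hq)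

/-- The geodesic cone from `a` over the side `bc` is a spanning surface. -/
lemma isSpanningSurface_geo {a b c : Cn n} (ha : a ∈ ball n) (hb : b ∈ ball n) (hc : c ∈ ball n) :
    IsSpanningSurface a b c (fun p => geo a (geo b c p.2) p.1) := by
  have hw : ∀ t ∈ Set.Icc (0 : ℝ) 1, geo b c t ∈ ball n := fun t ht =>
    (geo_mem_geodesicSegment hb hc ht).1
  have m1 : (1 : ℝ) ∈ Set.Icc (0 : ℝ) 1 := by simp
  refine ⟨?_, ?_, ?_, ?_, ?_, ?_, ?_, ?_⟩
  · exact contDiffOn_geo contDiffOn_const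
      (contDiffOn_geo contDiffOn_const contDiffOn_const contDiffOn_snd (fun _ _ => hb)
        (fun _ _ => hc) fun p hp => hp.2) contDiffOn_fst (fun _ _ => ha)
        (fun p hp => hw _ hp.2) fun p hp => hp.1
  · exact fun p hp => (geo_mem_geodesicSegment ha (hw _ hp.2) hp.1).1
  · exact fun t _ => geo_zero _ _
  · simp only [geo_zero]; exact geo_one ha hb
  · simp only [geo_one hb hc]; exact geo_one ha hc
  · intro s hs
    simp only [geo_zero]
    exact geo_mem_geodesicSegment ha hb hs
  · intro t ht
    simp only [geo_one ha (hw t ht)]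
    exact geo_mem_geodesicSegment hb hc ht
  · intro s hs
    simp only [geo_one hb hc]
    exact geo_mem_geodesicSegment ha hc hs

/-- The symplectic area of a geodesic triangle is twice its angular invariant. -/
lemma hasSymplecticArea {a b c : Cn n} (ha : a ∈ ball n) (hb : b ∈ ball n) (hc : c ∈ ball n) :
    HasSymplecticArea a b c (2 * angularInvariant a b c) :=
  ⟨⟨_, isSpanningSurface_geo ha hb hc⟩, fun _ hσ => hσ.integralOmega_eq ha hb hc⟩

/-! ### Complex geodesics and nearest points -/

lemma axis_add (ζ ξ : ℂ) : axis n (ζ + ξ) = axis n ζ + axis n ξ := by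
  ext k; simp [axis]; split_ifs <;> simp

lemma axis_smul (c ζ : ℂ) : axis n (c * ζ) = c • axis n ζ := by
  ext k; simp [axis]

lemma axis_zero : axis n 0 = 0 := by
  ext k; simp [axis]

/-- The complex geodesic that is the image of the slice under the automorphism `T`. -/
def slice (T : (Cn n × ℂ) ≃ₗ[ℂ] (Cn n × ℂ)) : Set (Cn n) := (fun ζ => act T (axis n ζ)) '' disk

lemma isComplexGeodesic_slice {T : (Cn n × ℂ) ≃ₗ[ℂ] (Cn n × ℂ)} (hT : Preserves T) :
    IsComplexGeodesic (slice T) :=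
  ⟨fun ζ => act T (axis n ζ), ⟨act T, ⟨T, hT, fun _ _ => rfl⟩, fun _ _ => rfl⟩, rfl⟩

section axis

variable [NeZero n]

lemma inner_axis (ζ : ℂ) (v : Cn n) : inner ℂ (axis n ζ) v = (starRingEnd ℂ) ζ * v 0 := by
  have : axis n ζ = EuclideanSpace.single 0 ζ := by
    ext k
    rw [PiLp.single_apply]
    simp only [axis, Fin.ext_iff, Fin.val_zero]
  rw [this, EuclideanSpace.inner_single_left]

lemma axis_apply_zero (ζ : ℂ) : axis n ζ 0 = ζ := by simp [axis]

lemma inner_axis_axis (ζ ξ : ℂ) : inner ℂ (axis n ζ) (axis n ξ) = (starRingEnd ℂ) ζ * ξ := by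
  rw [inner_axis, axis_apply_zero]

lemma inner_right_axis (ζ : ℂ) (v : Cn n) :
    inner ℂ v (axis n ζ) = (starRingEnd ℂ) (v 0) * ζ := by
  rw [← inner_conj_symm, inner_axis]; simp [mul_comm]

lemma norm_axis (ζ : ℂ) : ‖axis n ζ‖ = ‖ζ‖ := by
  have h := inner_axis_axis (n := n) ζ ζ
  rw [inner_self_ofReal, mul_comm, Complex.mul_conj, Complex.normSq_eq_norm_sq] at h
  exact (pow_left_inj₀ (norm_nonneg _) (norm_nonneg _) two_ne_zero).1 (Complex.ofReal_injective h)

lemma axis_injective : Function.Injective (axis n) := fun ζ ξ h => by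
  rw [← axis_apply_zero (n := n) ζ, h, axis_apply_zero]

lemma mem_disk_iff {ζ : ℂ} : ζ ∈ disk ↔ ‖ζ‖ < 1 := by simp [disk]

lemma axis_mem_ball_iff {ζ : ℂ} : axis n ζ ∈ ball n ↔ ζ ∈ disk := by
  rw [mem_ball_iff, norm_axis, mem_disk_iff]

lemma apply_zero_mem_disk {y : Cn n} (hy : y ∈ ball n) : y 0 ∈ disk :=
  mem_disk_iff.2 ((PiLp.norm_apply_le y 0).trans_lt (mem_ball_iff.1 hy))

lemma IsDiskChart.exists_slice {ψ : ℂ → Cn n} {G : Set (Cn n)} (h : IsDiskChart ψ G) :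
    ∃ T, Preserves T ∧ (∀ ζ ∈ disk, ψ ζ = act T (axis n ζ)) ∧ G = slice T := by
  obtain ⟨⟨f, ⟨T, hT, hf⟩, hψ⟩, rfl⟩ := h
  have h1 : ∀ ζ ∈ disk, ψ ζ = act T (axis n ζ) := fun ζ hζ => by
    rw [hψ ζ hζ, hf _ (axis_mem_ball_iff.2 hζ)]; rfl
  exact ⟨T, hT, h1, Set.image_congr h1⟩

/-- A complex geodesic is the part in the ball of a complex projective line, and two distinct points
determine that line. -/
lemma mem_slice_span {T : (Cn n × ℂ) ≃ₗ[ℂ] (Cn n × ℂ)} (hT : Preserves T) {p q z : Cn n}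
    (hp : p ∈ slice T) (hq : q ∈ slice T) (hpq : p ≠ q) (hz : z ∈ ball n) :
    z ∈ slice T ↔ (z, (1 : ℂ)) ∈ Submodule.span ℂ {(p, (1 : ℂ)), (q, (1 : ℂ))} := by
  obtain ⟨α, hα, rfl⟩ := hp
  obtain ⟨β, hβ, rfl⟩ := hq
  have hαb := axis_mem_ball_iff (n := n).2 hα
  have hβb := axis_mem_ball_iff (n := n).2 hβ
  have hne : α - β ≠ 0 := fun h => hpq (by rw [sub_eq_zero.1 h])
  have h1 := snd_ne_zero hT hαb
  have h2 := snd_ne_zero hT hβb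
  have e1 := lift_act hT hαb
  have e2 := lift_act hT hβb
  rw [Submodule.mem_span_pair]
  constructor
  · rintro ⟨ζ, hζ, rfl⟩
    have hζb := axis_mem_ball_iff (n := n).2 hζ
    have h3 := snd_ne_zero hT hζb
    have e3 := lift_act hT hζb
    have e : (axis n ζ, (1 : ℂ)) = ((ζ - β) / (α - β)) • (axis n α, (1 : ℂ))
        + ((α - ζ) / (α - β)) • (axis n β, (1 : ℂ)) := by
      ext1
      · simp only [Prod.smul_mk, Prod.mk_add_mk, ← axis_smul, ← axis_add]
        congr 1; field_simp; ring
      · simp only [Prod.smul_mk, Prod.mk_add_mk, smul_eq_mul]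
        field_simp; ring
    refine ⟨(T (axis n ζ, 1)).2⁻¹ * ((ζ - β) / (α - β) * (T (axis n α, 1)).2),
      (T (axis n ζ, 1)).2⁻¹ * ((α - ζ) / (α - β) * (T (axis n β, 1)).2), ?_⟩
    rw [mul_smul, mul_smul, mul_smul, mul_smul, ← e1, ← e2, ← smul_add, ← map_smul, ← map_smul,
      ← map_add, ← e, e3, smul_smul]
    simp [h3]
  · rintro ⟨c, d, h⟩
    have h4 := congrArg T.symm h
    have f1 : T.symm (act T (axis n α), 1) = (T (axis n α, 1)).2⁻¹ • (axis n α, (1 : ℂ)) := by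
      rw [LinearEquiv.symm_apply_eq, map_smul, e1, smul_smul]; simp [h1]
    have f2 : T.symm (act T (axis n β), 1) = (T (axis n β, 1)).2⁻¹ • (axis n β, (1 : ℂ)) := by
      rw [LinearEquiv.symm_apply_eq, map_smul, e2, smul_smul]; simp [h2]
    rw [map_add, map_smul, map_smul, f1, f2, lift_act hT.symm hz] at h4
    have h5 := congrArg Prod.fst h4
    have h6 := snd_ne_zero hT.symm hz
    simp only [Prod.smul_mk, Prod.mk_add_mk, ← axis_smul, ← axis_add] at h5
    have h7 : act T.symm z = axis n ((T.symm (z, 1)).2⁻¹ *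
        (c * ((T (axis n α, 1)).2⁻¹ * α) + d * ((T (axis n β, 1)).2⁻¹ * β))) := by
      rw [axis_smul, h5, smul_smul, inv_mul_cancel₀ h6, one_smul]
    refine ⟨_, axis_mem_ball_iff.1 (h7 ▸ act_mem hT.symm hz), ?_⟩
    change act T (axis n _) = z
    rw [← h7, act_act_symm hT hz]

lemma slice_subset_ball {T : (Cn n × ℂ) ≃ₗ[ℂ] (Cn n × ℂ)} (hT : Preserves T) :
    slice T ⊆ ball n := by
  rintro _ ⟨ζ, hζ, rfl⟩
  exact act_mem hT (axis_mem_ball_iff.2 hζ)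

/-- A complex geodesic is determined by two of its points. -/
lemma IsComplexGeodesic.eq_of_mem {G H : Set (Cn n)} (hG : IsComplexGeodesic G)
    (hH : IsComplexGeodesic H) {p q : Cn n} (hpq : p ≠ q) (hpG : p ∈ G) (hqG : q ∈ G)
    (hpH : p ∈ H) (hqH : q ∈ H) : G = H := by
  obtain ⟨_, hψ⟩ := hG
  obtain ⟨S, hS, -, rfl⟩ := hψ.exists_slice
  obtain ⟨_, hψ'⟩ := hH
  obtain ⟨T, hT, -, rfl⟩ := hψ'.exists_slice
  ext z
  constructor <;> intro h
  · have hz := slice_subset_ball hS h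
    rwa [mem_slice_span hS hpG hqG hpq hz, ← mem_slice_span hT hpH hqH hpq hz] at h
  · have hz := slice_subset_ball hT h
    rwa [mem_slice_span hT hpH hqH hpq hz, ← mem_slice_span hS hpG hqG hpq hz] at h

/-- The stabilizer of `0` carries the slice to any complex line through `0`. -/
lemma exists_act_axis {q : Cn n} (hq : q ∈ ball n) (hq0 : q ≠ 0) :
    ∃ T, Preserves T ∧ act T 0 = (0 : Cn n) ∧ ∃ ζ ∈ disk, act T (axis n ζ) = q := by
  -- The modulus gives `(axis n μ, 0)` and `(q, 0)` equal form values. The phase makes their product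
  -- real and nonnegative, so `refl_swap` applies and the reflection vector is not null. The swap
  -- introduces a sign, so the preimage of `q` is `axis n (-μ)`.
  set μ : ℂ := ‖q‖ * Complex.exp ((q 0).arg * Complex.I) with hμ
  have hμn : ‖μ‖ = ‖q‖ := by
    rw [hμ, norm_mul, Complex.norm_exp_ofReal_mul_I]; simp
  have hin : (inner ℂ q (axis n μ) : ℂ) = ((‖q‖ * ‖q 0‖ : ℝ) : ℂ) := by
    have h1 := Complex.norm_mul_exp_arg_mul_I (q 0)
    have h2 : (starRingEnd ℂ) (Complex.exp ((q 0).arg * Complex.I))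
        * Complex.exp ((q 0).arg * Complex.I) = 1 := by
      rw [mul_comm, Complex.mul_conj, Complex.normSq_eq_norm_sq, Complex.norm_exp_ofReal_mul_I]
      simp
    rw [inner_right_axis]
    conv_lhs => rw [← h1]
    rw [map_mul, Complex.conj_ofReal, hμ]
    push_cast
    linear_combination (‖q‖ * ‖q 0‖ : ℂ) * h2
  set X : Cn n × ℂ := (axis n μ, 0) with hX
  set Y : Cn n × ℂ := (q, 0) with hY
  have e1 : form X X = ((‖q‖ ^ 2 : ℝ) : ℂ) := by
    rw [form_self, hX]; simp only [norm_axis, hμn]; simp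
  have e2 : form Y Y = ((‖q‖ ^ 2 : ℝ) : ℂ) := by rw [form_self, hY]; simp
  have e3 : form X Y = ((‖q‖ * ‖q 0‖ : ℝ) : ℂ) := by rw [form, hX, hY, hin]; simp
  have e4 : form Y X = ((‖q‖ * ‖q 0‖ : ℝ) : ℂ) := by rw [← form_conj, e3, Complex.conj_ofReal]
  have hq1 := norm_pos_iff.2 hq0
  have hV : form (X + Y) (X + Y) ≠ 0 := by
    rw [form_add_left, form_add_right, form_add_right, e1, e2, e3, e4, ← Complex.ofReal_add,
      ← Complex.ofReal_add, ← Complex.ofReal_add, Complex.ofReal_ne_zero]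
    positivity
  have h0 : refl (X + Y) hV (0, 1) = (0, 1) := by
    have : form (0, 1) (X + Y) = 0 := by simp [form, hX, hY]
    rw [refl_apply, this]; simp
  have h1 := refl_swap hV (e1.trans e2.symm) (e3.trans e4.symm)
  refine ⟨refl (X + Y) hV, refl_preserves _ _, act_eq_of_lift one_ne_zero (by simpa using h0),
    -μ, by rw [mem_disk_iff, norm_neg, hμn]; exact mem_ball_iff.1 hq,
    act_eq_of_lift one_ne_zero ?_⟩
  have h2 : (axis n (-μ), (1 : ℂ)) = (-1 : ℂ) • X + (0, 1) := by
    rw [hX, neg_eq_neg_one_mul, axis_smul]; simp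
  calc refl (X + Y) hV (axis n (-μ), 1) = refl (X + Y) hV ((-1 : ℂ) • X + (0, 1)) := congrArg _ h2
    _ = (1 : ℂ) • (q, (1 : ℂ)) := by rw [map_add, map_smul, h1, h0, hY]; simp

lemma geodesicSegment_subset_slice {T : (Cn n × ℂ) ≃ₗ[ℂ] (Cn n × ℂ)} (hT : Preserves T) {ζ : ℂ}
    (hζ : ζ ∈ disk) : geodesicSegment (act T 0) (act T (axis n ζ)) ⊆ slice T := by
  intro z hz
  have hζb := axis_mem_ball_iff (n := n).2 hζ
  have h := act_mem_geodesicSegment hT.symm (act_mem hT zero_mem_ball) (act_mem hT hζb) hz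
  rw [act_symm_act hT zero_mem_ball, act_symm_act hT hζb, mem_geodesicSegment_zero hζb] at h
  obtain ⟨t, -, h⟩ := h
  rw [← axis_smul] at h
  refine ⟨t * ζ, axis_mem_ball_iff.1 (h ▸ act_mem hT.symm hz.1), ?_⟩
  change act T (axis n _) = z
  rw [← h, act_act_symm hT hz.1]

/-- Two distinct points lie in a unique complex geodesic, and it contains their segment. -/
lemma existsUnique_complexGeodesic {p q : Cn n} (hp : p ∈ ball n) (hq : q ∈ ball n)
    (hpq : p ≠ q) :
    ∃! G : Set (Cn n), IsComplexGeodesic G ∧ geodesicSegment p q ⊆ G := by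
  obtain ⟨S, hS, hSp⟩ := exists_act_zero hp
  have hq' := act_mem hS.symm hq
  have hq'0 : act S.symm q ≠ 0 := fun h => hpq (by
    rw [← hSp, ← h, act_act_symm hS hq])
  obtain ⟨U, hU, hU0, ζ, hζ, hUq⟩ := exists_act_axis hq' hq'0
  have hT := hU.trans hS
  have hTp : act (U.trans S) 0 = p := by rw [act_trans hU hS zero_mem_ball, hU0, hSp]
  have hTq : act (U.trans S) (axis n ζ) = q := by
    rw [act_trans hU hS (axis_mem_ball_iff.2 hζ), hUq, act_act_symm hS hq]
  have hsub := geodesicSegment_subset_slice hT hζ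
  rw [hTp, hTq] at hsub
  refine ⟨_, ⟨isComplexGeodesic_slice hT, hsub⟩, fun G hG => ?_⟩
  have hl := left_mem_geodesicSegment hp hq
  have hr := right_mem_geodesicSegment hp hq
  exact hG.1.eq_of_mem (isComplexGeodesic_slice hT) hpq (hG.2 hl) (hG.2 hr) (hsub hl) (hsub hr)

/-- With `α = y 0`, the identity `key` gives `1 - ρ² = (1 - |y|²)/(1 - |α|²) · (1 - |ζ - α|²/|1 -
conj α ζ|²)`, whose unique maximum is at `ζ = α`. -/
lemma rho_axis_lt {y : Cn n} (hy : y ∈ ball n) {ζ : ℂ} (hζ : ζ ∈ disk) (hne : ζ ≠ y 0) :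
    rho y (axis n (y 0)) < rho y (axis n ζ) := by
  have hα := apply_zero_mem_disk hy
  set α := y 0 with hαd
  have key : ∀ ξ : ℂ, (1 - ‖α‖ ^ 2) * (1 - ‖ξ‖ ^ 2)
      = ‖(1 - inner ℂ y (axis n ξ) : ℂ)‖ ^ 2 - ‖ξ - α‖ ^ 2 := fun ξ => by
    rw [inner_right_axis, ← hαd]
    simp only [← Complex.normSq_eq_norm_sq, Complex.normSq_apply]
    simp; ring
  have h1 := one_sub_rho_sq hy (axis_mem_ball_iff (n := n).2 hζ)
  have h2 := one_sub_rho_sq hy (axis_mem_ball_iff (n := n).2 hα)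
  have k1 := key ζ
  have k2 := key α
  rw [sub_self, norm_zero] at k2
  rw [norm_axis] at h1 h2
  have p1 := norm_pos_iff.2 (one_sub_inner_ne_zero hy (axis_mem_ball_iff (n := n).2 hζ))
  have p2 := norm_pos_iff.2 (one_sub_inner_ne_zero hy (axis_mem_ball_iff (n := n).2 hα))
  have p3 := norm_pos_iff.2 (sub_ne_zero.2 hne)
  have p4 : 0 < 1 - ‖y‖ ^ 2 := by linarith [normSq_lt_one hy]
  have p5 : 0 < 1 - ‖α‖ ^ 2 := by nlinarith [mem_disk_iff.1 hα, norm_nonneg α]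
  refine lt_of_pow_lt_pow_left₀ 2 (rho_nonneg _ _) ?_
  set A := ‖(1 - inner ℂ y (axis n ζ) : ℂ)‖ ^ 2
  set B := ‖(1 - inner ℂ y (axis n α) : ℂ)‖ ^ 2
  have q1 : 0 < A := by positivity
  have q2 : 0 < B := by positivity
  have h3 : (1 - rho y (axis n α) ^ 2) * (1 - ‖α‖ ^ 2) = 1 - ‖y‖ ^ 2 := by
    refine mul_right_cancel₀ q2.ne' ?_
    linear_combination (1 - ‖α‖ ^ 2) * h2 + (1 - ‖y‖ ^ 2) * k2
  have h4 : (1 - rho y (axis n ζ) ^ 2) * (1 - ‖α‖ ^ 2) * A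
      = (1 - ‖y‖ ^ 2) * (A - ‖ζ - α‖ ^ 2) := by
    linear_combination (1 - ‖α‖ ^ 2) * h1 + (1 - ‖y‖ ^ 2) * k1
  have h5 : (rho y (axis n ζ) ^ 2 - rho y (axis n α) ^ 2) * ((1 - ‖α‖ ^ 2) * A)
      = (1 - ‖y‖ ^ 2) * ‖ζ - α‖ ^ 2 := by
    linear_combination A * h3 - h4
  have h6 : 0 < (1 - ‖y‖ ^ 2) * ‖ζ - α‖ ^ 2 := by positivity
  rw [← h5] at h6
  linarith [pos_of_mul_pos_left h6 (by positivity)]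

/-- The nearest point projection to a complex geodesic. -/
lemma isNearestPoint_slice_iff {T : (Cn n × ℂ) ≃ₗ[ℂ] (Cn n × ℂ)} (hT : Preserves T) {x p : Cn n}
    (hx : x ∈ ball n) :
    IsNearestPoint (slice T) x p ↔ p = act T (axis n (act T.symm x 0)) := by
  have hy := act_mem hT.symm hx
  set y := act T.symm x with hyd
  have hxy : x = act T y := (act_act_symm hT hx).symm
  have hα := apply_zero_mem_disk hy
  have hαb := axis_mem_ball_iff (n := n).2 hα
  have key : ∀ ζ ∈ disk, ζ ≠ y 0 →
      beta x (act T (axis n (y 0))) < beta x (act T (axis n ζ)) := fun ζ hζ hne => by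
    have hζb := axis_mem_ball_iff (n := n).2 hζ
    rw [hxy, beta_act hT hy hαb, beta_act hT hy hζb, beta, beta,
      Real.artanh_lt_artanh_iff (rho_mem hy hαb) (rho_mem hy hζb)]
    exact rho_axis_lt hy hζ hne
  constructor
  · rintro ⟨⟨ζ, hζ, rfl⟩, h⟩
    by_contra hne
    have hne' : ζ ≠ y 0 := fun h => hne (by rw [← h])
    exact absurd (h _ ⟨_, hα, rfl⟩) (not_le.2 (key ζ hζ hne'))
  · rintro rfl
    refine ⟨⟨_, hα, rfl⟩, ?_⟩
    rintro _ ⟨ζ, hζ, rfl⟩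
    by_cases h : ζ = y 0
    · rw [h]
    · exact (key ζ hζ h).le

end axis

/-! ### The area of a geodesic triangle in the disk -/

/-- The real linear map `h ↦ h.re • A + h.im • B` of the plane. -/
def planeMap (A B : ℂ) : ℂ →L[ℝ] ℂ := Complex.reCLM.smulRight A + Complex.imCLM.smulRight B

lemma planeMap_apply (A B h : ℂ) : planeMap A B h = h.re * A + h.im * B := by
  simp [planeMap]

lemma planeMap_det (A B : ℂ) : (planeMap A B).det = ((starRingEnd ℂ) A * B).im := by
  rw [ContinuousLinearMap.det, ← LinearMap.det_toMatrix Complex.basisOneI, Matrix.det_fin_two]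
  simp [LinearMap.toMatrix_apply, planeMap_apply]
  ring

/-- The homogeneous coordinate of `diskGeo b c t`. -/
def diskDen (b c : ℂ) (t : ℝ) : ℂ := (1 - t) + t * (1 - (starRingEnd ℂ) c * b)

/-- The point of parameter `t` of the geodesic segment from `b` to `c` in the disk. -/
def diskGeo (b c : ℂ) (t : ℝ) : ℂ :=
  ((1 - t) * b + t * (1 - (starRingEnd ℂ) c * b) * c) / diskDen b c t

/-- The derivative of `diskGeo b c`. -/
def diskGeoDeriv (b c : ℂ) (t : ℝ) : ℂ :=
  (1 - (starRingEnd ℂ) c * b) * (c - b) / diskDen b c t ^ 2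

/-- Up to a positive factor, the angular velocity of `diskGeo b c` relative to that at `0`. -/
def diskWeight (b c : ℂ) (t : ℝ) : ℝ :=
  ((1 - t) ^ 2 * (1 - Complex.normSq b)
    + Complex.normSq (1 - (starRingEnd ℂ) c * b) * (2 * t * (1 - t) + t ^ 2 * (1 - Complex.normSq c)))
    / Complex.normSq (diskDen b c t) ^ 2

lemma normSq_lt_one_of_mem_disk {ζ : ℂ} (h : ζ ∈ disk) : Complex.normSq ζ < 1 := by
  rw [mem_disk_iff] at h
  rw [Complex.normSq_eq_norm_sq]
  nlinarith [norm_nonneg ζ]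

lemma one_sub_conj_mul_ne_zero {b c : ℂ} (hb : b ∈ disk) (hc : c ∈ disk) :
    1 - (starRingEnd ℂ) c * b ≠ 0 := by
  have := one_sub_inner_ne_zero (axis_mem_ball_iff (n := 1).2 hc) (axis_mem_ball_iff (n := 1).2 hb)
  rwa [inner_axis_axis] at this

lemma diskDen_ne_zero {b c : ℂ} (hb : b ∈ disk) (hc : c ∈ disk) {t : ℝ}
    (ht : t ∈ Set.Icc (0 : ℝ) 1) : diskDen b c t ≠ 0 := by
  have := geoDen_ne_zero (axis_mem_ball_iff (n := 1).2 hb) (axis_mem_ball_iff (n := 1).2 hc) ht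
  rwa [geoDen, inner_axis_axis] at this

lemma geo_axis [NeZero n] (b c : ℂ) (t : ℝ) :
    geo (axis n b) (axis n c) t = axis n (diskGeo b c t) := by
  rw [geo, geoDen, inner_axis_axis, ← axis_smul, ← axis_smul, ← axis_add, ← axis_smul, diskGeo,
    diskDen, div_eq_inv_mul]

lemma diskWeight_nonneg {b c : ℂ} (hb : b ∈ disk) (hc : c ∈ disk) {t : ℝ}
    (ht : t ∈ Set.Icc (0 : ℝ) 1) : 0 ≤ diskWeight b c t := by
  have h1 : 0 ≤ 1 - Complex.normSq b := by linarith [normSq_lt_one_of_mem_disk hb]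
  have h2 : 0 ≤ 1 - Complex.normSq c := by linarith [normSq_lt_one_of_mem_disk hc]
  have h3 : 0 ≤ 1 - t := by linarith [ht.2]
  have h4 := ht.1
  have h5 := Complex.normSq_nonneg (1 - (starRingEnd ℂ) c * b)
  unfold diskWeight
  positivity

/-- Seen from `0`, a geodesic turns in one direction only, given by the sign of `Im (conj b * c)`;
this fixes the sign of the Jacobian of `cone`. -/
lemma diskGeo_im (b c : ℂ) (t : ℝ) :
    ((starRingEnd ℂ) (diskGeo b c t) * diskGeoDeriv b c t).im
      = ((starRingEnd ℂ) b * c).im * diskWeight b c t := by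
  -- At a zero denominator both sides vanish by the convention for division by zero, so no disk
  -- hypothesis is needed.
  rcases eq_or_ne (diskDen b c t) 0 with h0 | h0
  · simp [diskGeo, diskWeight, h0]
  have hN : Complex.normSq (diskDen b c t) ≠ 0 := (Complex.normSq_pos.2 h0).ne'
  have hc0 : (starRingEnd ℂ) (diskDen b c t) ≠ 0 := by simpa using h0
  have h1 : (starRingEnd ℂ) (diskGeo b c t) * diskGeoDeriv b c t
      = ((starRingEnd ℂ) (((1 - t) * b + t * (1 - (starRingEnd ℂ) c * b) * c) * diskDen b c t)
          * ((1 - (starRingEnd ℂ) c * b) * (c - b)))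
        / ((Complex.normSq (diskDen b c t) ^ 2 : ℝ) : ℂ) := by
    rw [diskGeo, diskGeoDeriv, map_div₀, Complex.ofReal_pow, ← Complex.mul_conj, map_mul]
    field_simp
  rw [h1, Complex.div_ofReal_im, diskWeight, ← mul_div_assoc]
  congr 1
  simp [diskDen, Complex.normSq_apply]
  ring

lemma hasDerivAt_diskGeo {b c : ℂ} {t : ℝ} (h : diskDen b c t ≠ 0) :
    HasDerivAt (diskGeo b c) (diskGeoDeriv b c t) t := by
  have h0 : HasDerivAt (fun t : ℝ => (t : ℂ)) 1 t := by
    simpa using (hasDerivAt_id t).ofReal_comp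
  have h1 := (((hasDerivAt_const t (1 : ℂ)).sub h0).mul_const b).add
    ((h0.mul_const (1 - (starRingEnd ℂ) c * b)).mul_const c)
  have h2 := ((hasDerivAt_const t (1 : ℂ)).sub h0).add
    (h0.mul_const (1 - (starRingEnd ℂ) c * b))
  refine (h1.div h2 h).congr_deriv ?_
  rw [diskGeoDeriv]
  congr 1
  simp
  ring

/-- The cone with apex `0` over the geodesic segment from `b` to `c`, parametrized on the plane. -/
def cone (b c ξ : ℂ) : ℂ := ξ.re * diskGeo b c ξ.im

lemma hasFDerivAt_cone {b c ξ : ℂ} (h : diskDen b c ξ.im ≠ 0) :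
    HasFDerivAt (cone b c) (planeMap (diskGeo b c ξ.im) (ξ.re * diskGeoDeriv b c ξ.im)) ξ := by
  have h1 : HasFDerivAt (fun ξ : ℂ => (ξ.re : ℂ)) (Complex.ofRealCLM.comp Complex.reCLM) ξ :=
    (Complex.ofRealCLM.comp Complex.reCLM).hasFDerivAt
  have h' : HasDerivAt (diskGeo b c) (diskGeoDeriv b c ξ.im) (Complex.imCLM ξ) :=
    hasDerivAt_diskGeo h
  have h2 := h'.hasFDerivAt.comp ξ Complex.imCLM.hasFDerivAt
  refine (h1.mul h2).congr_fderiv ?_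
  ext
  simp [planeMap_apply]
  ring

/-- Multiplying by the conjugate denominator gives real coordinates in `b`, `c`, in which
injectivity of the cone can be tested. -/
lemma diskGeo_mul_normSq {b c : ℂ} {t : ℝ} (h0 : diskDen b c t ≠ 0) :
    diskGeo b c t * Complex.normSq (diskDen b c t) =
      ((1 - t) * ((1 - t) + t * (1 - Complex.normSq c)) : ℝ) * b
      + (t * ((1 - t) * (1 - Complex.normSq b)
          + t * Complex.normSq (1 - (starRingEnd ℂ) c * b)) : ℝ) * c := by
  rw [← Complex.mul_conj, ← mul_assoc, diskGeo, div_mul_cancel₀ _ h0]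
  push_cast
  rw [← Complex.mul_conj, ← Complex.mul_conj, ← Complex.mul_conj]
  simp only [diskDen, map_add, map_sub, map_mul, map_one, Complex.conj_ofReal, Complex.conj_conj]
  ring

lemma coords_unique {b c : ℂ} (h : ((starRingEnd ℂ) b * c).im ≠ 0) {x y x' y' : ℝ}
    (e : (x : ℂ) * b + y * c = x' * b + y' * c) : x = x' ∧ y = y' := by
  have h1 := congrArg Complex.re e
  have h2 := congrArg Complex.im e
  simp at h h1 h2
  constructor
  · refine mul_right_cancel₀ h ?_
    linear_combination c.im * h1 - c.re * h2
  · refine mul_right_cancel₀ h ?_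
    linear_combination b.re * h2 - b.im * h1

/-- The open unit square of the plane. -/
def openBox : Set ℂ := Complex.measurableEquivRealProd ⁻¹' openSquare

/-- The closed unit square of the plane. -/
def box : Set ℂ := Complex.measurableEquivRealProd ⁻¹' square

lemma cone_injOn {b c : ℂ} (hb : b ∈ disk) (hc : c ∈ disk)
    (h : ((starRingEnd ℂ) b * c).im ≠ 0) : Set.InjOn (cone b c) openBox := by
  rintro ⟨s, t⟩ ⟨hs, ht⟩ ⟨s', t'⟩ ⟨hs', ht'⟩ e
  replace hs : 0 < s := hs.1
  replace hs' : 0 < s' := hs'.1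
  have htI : t ∈ Set.Icc (0 : ℝ) 1 := Set.Ioo_subset_Icc_self ht
  have htI' : t' ∈ Set.Icc (0 : ℝ) 1 := Set.Ioo_subset_Icc_self ht'
  obtain ⟨ht0, ht1⟩ : 0 < t ∧ t < 1 := ht
  obtain ⟨ht0', ht1'⟩ : 0 < t' ∧ t' < 1 := ht'
  have n1 := diskDen_ne_zero hb hc htI
  have n2 := diskDen_ne_zero hb hc htI'
  replace e : (s : ℂ) * diskGeo b c t = s' * diskGeo b c t' := e
  have d1 := diskGeo_mul_normSq n1
  have d2 := diskGeo_mul_normSq n2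
  have p1 := Complex.normSq_pos.2 n1
  have p2 := Complex.normSq_pos.2 n2
  have hB : 0 < 1 - Complex.normSq b := by linarith [normSq_lt_one_of_mem_disk hb]
  have hC : 0 < 1 - Complex.normSq c := by linarith [normSq_lt_one_of_mem_disk hc]
  have hM := Complex.normSq_pos.2 (one_sub_conj_mul_ne_zero hb hc)
  set B := 1 - Complex.normSq b
  set C := 1 - Complex.normSq c
  set M := Complex.normSq (1 - (starRingEnd ℂ) c * b)
  set P := Complex.normSq (diskDen b c t) with hP
  set P' := Complex.normSq (diskDen b c t') with hP'
  obtain ⟨ex, ey⟩ := coords_unique h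
    (x := s * P' * ((1 - t) * ((1 - t) + t * C))) (y := s * P' * (t * ((1 - t) * B + t * M)))
    (x' := s' * P * ((1 - t') * ((1 - t') + t' * C)))
    (y' := s' * P * (t' * ((1 - t') * B + t' * M))) (by
      push_cast at d1 d2 ⊢
      linear_combination (P * P' : ℂ) * e - (s * P' : ℂ) * d1 + (s' * P : ℂ) * d2)
  -- The ratio of the two coordinates no longer involves `s`, and it determines `t`: the cross
  -- difference is `t' - t` times a positive factor.
  have hx : (1 - t) * ((1 - t) + t * C) * (t' * ((1 - t') * B + t' * M))
      = (1 - t') * ((1 - t') + t' * C) * (t * ((1 - t) * B + t * M)) := by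
    refine mul_left_cancel₀ (a := (s * P') * (s' * P)) (by positivity) ?_
    linear_combination s' * P * (t' * ((1 - t') * B + t' * M)) * ex
      - s' * P * ((1 - t') * ((1 - t') + t' * C)) * ey
  have u1 : 0 < 1 - t := by linarith
  have u2 : 0 < 1 - t' := by linarith
  have htt : t = t' := by
    have hf : (t' - t) * (B * (1 - t) * (1 - t')
        + M * ((1 - t) * t' + (1 - t') * t + C * t * t')) = 0 := by
      linear_combination hx
    have : 0 < B * (1 - t) * (1 - t') + M * ((1 - t) * t' + (1 - t') * t + C * t * t') := by
      positivity
    rcases mul_eq_zero.1 hf with h | h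
    · linarith
    · linarith
  subst htt
  have hss : s = s' := by
    refine mul_right_cancel₀ (b := P * (t * ((1 - t) * B + t * M))) (by positivity) ?_
    linear_combination ey
  rw [hss]

lemma openBox_ae_eq : openBox =ᵐ[MeasureTheory.volume] box :=
  Complex.volume_preserving_equiv_real_prod.quasiMeasurePreserving.preimage_ae_eq openSquare_ae_eq

lemma measurableSet_openBox : MeasurableSet openBox :=
  Complex.measurableEquivRealProd.measurable isOpen_openSquare.measurableSet

lemma openBox_subset : openBox ⊆ box := Set.preimage_mono openSquare_subset

lemma diskDen_ne_zero_of_mem_box {b c : ℂ} (hb : b ∈ disk) (hc : c ∈ disk) {ξ : ℂ}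
    (hξ : ξ ∈ box) : diskDen b c ξ.im ≠ 0 := diskDen_ne_zero hb hc hξ.2

/-- The boundary of the box is null and differentiable maps preserve null sets. Injectivity fails on
the edge sent to `0`, so the open box has to be used. -/
lemma cone_image_ae_eq {b c : ℂ} (hb : b ∈ disk) (hc : c ∈ disk) :
    (cone b c '' box : Set ℂ) =ᵐ[MeasureTheory.volume] cone b c '' openBox := by
  rw [MeasureTheory.ae_eq_set]
  constructor
  · refine MeasureTheory.measure_mono_null (t := cone b c '' (box \ openBox))
      (by rintro _ ⟨⟨ξ, hξ, rfl⟩, hn⟩; exact ⟨ξ, ⟨hξ, fun h => hn ⟨ξ, h, rfl⟩⟩, rfl⟩) ?_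
    refine MeasureTheory.addHaar_image_eq_zero_of_differentiableOn_of_addHaar_eq_zero _ ?_
      (MeasureTheory.ae_eq_set.1 openBox_ae_eq).2
    exact fun ξ hξ => (hasFDerivAt_cone
      (diskDen_ne_zero_of_mem_box hb hc hξ.1)).differentiableAt.differentiableWithinAt
  · rw [Set.sdiff_eq_empty.2 (Set.image_mono openBox_subset), MeasureTheory.measure_empty]

lemma omega_axis [NeZero n] (z A B : ℂ) :
    omega (axis n z) (axis n A) (axis n B)
      = ((starRingEnd ℂ) A * B).im * (4 / (1 - ‖z‖ ^ 2) ^ 2) := by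
  rw [omega, inner_axis_axis, inner_axis_axis, inner_axis_axis, norm_axis]
  have h : (((1 - ‖z‖ ^ 2 : ℝ) : ℂ) * ((starRingEnd ℂ) A * B)
      + (starRingEnd ℂ) A * z * ((starRingEnd ℂ) z * B)) = (starRingEnd ℂ) A * B := by
    rw [← Complex.normSq_eq_norm_sq]
    push_cast
    rw [← Complex.mul_conj]
    ring
  rw [h]
  ring

/-- `axis n` as a continuous real linear map. -/
def axisL (n : ℕ) : ℂ →L[ℝ] Cn n :=
  ((ContinuousLinearMap.id ℂ ℂ).smulRight (axis n 1)).restrictScalars ℝ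

lemma axisL_apply (ζ : ℂ) : axisL n ζ = axis n ζ := by
  simp [axisL, ← axis_smul]

section cone

variable [NeZero n] {b c : ℂ}

lemma geo_zero_axis (b c : ℂ) (p : ℝ × ℝ) :
    geo 0 (geo (axis n b) (axis n c) p.2) p.1
      = axis n (cone b c (Complex.equivRealProdCLM.symm p)) := by
  rw [geo_zero_left, geo_axis, ← axis_smul]
  rfl

lemma omega_cone (hb : b ∈ disk) (hc : c ∈ disk) {p : ℝ × ℝ} (hp : p ∈ square) :
    omega (axis n (cone b c (Complex.equivRealProdCLM.symm p)))
      (fderivWithin ℝ (fun p : ℝ × ℝ => geo 0 (geo (axis n b) (axis n c) p.2) p.1) square p (1, 0))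
      (fderivWithin ℝ (fun p : ℝ × ℝ => geo 0 (geo (axis n b) (axis n c) p.2) p.1) square p (0, 1))
      = (planeMap (diskGeo b c p.2) (p.1 * diskGeoDeriv b c p.2)).det
        * (4 / (1 - ‖cone b c (Complex.equivRealProdCLM.symm p)‖ ^ 2) ^ 2) := by
  have h1 : HasFDerivAt (cone b c) (planeMap (diskGeo b c p.2) (p.1 * diskGeoDeriv b c p.2))
      (Complex.equivRealProdCLM.symm p) := by
    have := hasFDerivAt_cone (ξ := Complex.equivRealProdCLM.symm p) (diskDen_ne_zero hb hc hp.2)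
    simpa using this
  have h2 := (axisL n).hasFDerivAt.comp p
    (h1.comp p Complex.equivRealProdCLM.symm.hasFDerivAt)
  have h3 : HasFDerivAt (fun p : ℝ × ℝ => geo 0 (geo (axis n b) (axis n c) p.2) p.1) _ p :=
    h2.congr_of_eventuallyEq (.of_forall fun p => (geo_zero_axis b c p).trans (axisL_apply _).symm)
  rw [h3.hasFDerivWithinAt.fderivWithin (uniqueDiffOn_square p hp), planeMap_det]
  simp only [ContinuousLinearMap.comp_apply, ContinuousLinearEquiv.coe_coe, axisL_apply]
  rw [omega_axis, planeMap_apply, planeMap_apply]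
  simp

lemma angularInvariant_eq_integral (hb : b ∈ disk) (hc : c ∈ disk) :
    2 * angularInvariant 0 (axis n b) (axis n c) =
      ∫ p in square, (planeMap (diskGeo b c p.2) (p.1 * diskGeoDeriv b c p.2)).det
        * (4 / (1 - ‖cone b c (Complex.equivRealProdCLM.symm p)‖ ^ 2) ^ 2) := by
  have hb' := axis_mem_ball_iff (n := n).2 hb
  have hc' := axis_mem_ball_iff (n := n).2 hc
  rw [← (isSpanningSurface_geo zero_mem_ball hb' hc').integralOmega_eq zero_mem_ball hb' hc',
    integralOmega]
  refine MeasureTheory.setIntegral_congr_fun isCompact_square.measurableSet fun p hp => ?_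
  rw [← omega_cone (n := n) hb hc hp, ← geo_zero_axis]

lemma integrableOn_cone (hb : b ∈ disk) (hc : c ∈ disk) :
    MeasureTheory.IntegrableOn (fun p : ℝ × ℝ =>
      (planeMap (diskGeo b c p.2) (p.1 * diskGeoDeriv b c p.2)).det
        * (4 / (1 - ‖cone b c (Complex.equivRealProdCLM.symm p)‖ ^ 2) ^ 2)) square := by
  have h := isSpanningSurface_geo (n := 1) zero_mem_ball (axis_mem_ball_iff.2 hb)
    (axis_mem_ball_iff.2 hc)
  refine (integrableOn_omega h.smooth h.mem_ball).congr_fun (fun p hp => ?_)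
    isCompact_square.measurableSet
  simp only
  rw [← omega_cone (n := 1) hb hc hp, ← geo_zero_axis]

lemma det_cone_eq (b c : ℂ) (p : ℝ × ℝ) :
    (planeMap (diskGeo b c p.2) (p.1 * diskGeoDeriv b c p.2)).det
      = ((starRingEnd ℂ) b * c).im * (p.1 * diskWeight b c p.2) := by
  rw [planeMap_det, mul_left_comm, Complex.im_ofReal_mul, diskGeo_im]
  ring

/-- The signed integrand is `κ` times a nonnegative function, so its integral and the area agree up
to sign. -/
lemma hypArea_cone (hb : b ∈ disk) (hc : c ∈ disk) :
    hypArea (cone b c '' box)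
      = ENNReal.ofReal |2 * angularInvariant 0 (axis n b) (axis n c)| := by
  set om : ℝ × ℝ → ℝ := fun p =>
    (planeMap (diskGeo b c p.2) (p.1 * diskGeoDeriv b c p.2)).det
      * (4 / (1 - ‖cone b c (Complex.equivRealProdCLM.symm p)‖ ^ 2) ^ 2) with hom
  have hA : 2 * angularInvariant 0 (axis n b) (axis n c) = ∫ p in openSquare, om p := by
    rw [angularInvariant_eq_integral hb hc]
    exact (MeasureTheory.setIntegral_congr_set openSquare_ae_eq).symm
  have hd : ∀ ξ ∈ openBox, HasFDerivWithinAt (cone b c)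
      (planeMap (diskGeo b c ξ.im) (ξ.re * diskGeoDeriv b c ξ.im)) openBox ξ := fun ξ hξ =>
    (hasFDerivAt_cone (diskDen_ne_zero_of_mem_box hb hc (openBox_subset hξ))).hasFDerivWithinAt
  rw [hA, hypArea, MeasureTheory.setLIntegral_congr (cone_image_ae_eq hb hc)]
  set κ := ((starRingEnd ℂ) b * c).im with hκ
  -- Here `0`, `b`, `c` are collinear over the reals: the Jacobian vanishes identically, so the
  -- image is null and the signed integral is zero.
  by_cases h0 : κ = 0
  · rw [MeasureTheory.setLIntegral_measure_zero, MeasureTheory.setIntegral_congr_fun (g := 0)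
      isOpen_openSquare.measurableSet]
    · simp
    · intro p _
      simp only [hom, det_cone_eq, ← hκ, h0]
      simp
    · refine MeasureTheory.addHaar_image_eq_zero_of_det_fderivWithin_eq_zero _ hd fun ξ _ => ?_
      have := det_cone_eq b c (ξ.re, ξ.im)
      rw [← hκ, h0, zero_mul] at this
      exact this
  · have hsgn : ∀ p ∈ openSquare, |om p| = |κ| / κ * om p := fun p hp => by
      have hp' := openSquare_subset hp
      have hw := diskWeight_nonneg hb hc hp'.2
      have hm : 0 ≤ (p.1 * diskWeight b c p.2)
          * (4 / (1 - ‖cone b c (Complex.equivRealProdCLM.symm p)‖ ^ 2) ^ 2) :=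
        mul_nonneg (mul_nonneg hp'.1.1 hw) (by positivity)
      have : om p = κ * ((p.1 * diskWeight b c p.2)
          * (4 / (1 - ‖cone b c (Complex.equivRealProdCLM.symm p)‖ ^ 2) ^ 2)) := by
        simp only [hom, det_cone_eq, ← hκ]; ring
      rw [this, abs_mul, abs_of_nonneg hm]
      field_simp
    have hint := (integrableOn_cone hb hc).mono_set openSquare_subset
    have habs : |∫ p in openSquare, om p| = ∫ p in openSquare, |om p| := by
      have h1 : 0 ≤ ∫ p in openSquare, |om p| :=
        MeasureTheory.integral_nonneg fun _ => abs_nonneg _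
      rw [← abs_of_nonneg h1, MeasureTheory.setIntegral_congr_fun
        isOpen_openSquare.measurableSet hsgn, MeasureTheory.integral_const_mul, abs_mul, abs_div,
        abs_abs, div_self (abs_ne_zero.2 h0), one_mul]
    rw [habs, MeasureTheory.lintegral_image_eq_lintegral_abs_det_fderiv_mul _
      measurableSet_openBox hd (cone_injOn hb hc h0),
      MeasureTheory.ofReal_integral_eq_lintegral_ofReal hint.abs
        (Filter.Eventually.of_forall fun _ => abs_nonneg _),
      ← Complex.volume_preserving_equiv_real_prod.setLIntegral_comp_preimage_emb
        Complex.measurableEquivRealProd.measurableEmbedding]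
    refine MeasureTheory.setLIntegral_congr_fun measurableSet_openBox fun ξ _ => ?_
    rw [← ENNReal.ofReal_mul (abs_nonneg _), abs_mul,
      abs_of_nonneg (a := 4 / _) (by positivity)]
    rfl

end cone

/-! ### Invariance of the area, and triangles in general position -/

/-- The involutive automorphism of the disk exchanging `0` and `α`. -/
def mobius (α ζ : ℂ) : ℂ := (α - ζ) / (1 - (starRingEnd ℂ) α * ζ)

lemma mobius_self (α : ℂ) : mobius α α = 0 := by simp [mobius]

/-- The explicit exchange of `0` and `axis n α` preserves the slice, so Möbius maps of the disk
inherit the invariance properties of automorphisms. -/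
lemma exists_act_mobius [NeZero n] {α : ℂ} (hα : α ∈ disk) :
    ∃ T, Preserves T ∧ ∀ ζ ∈ disk, act T (axis n ζ) = axis n (mobius α ζ) := by
  obtain ⟨T, s, hT, hs, hs2, h⟩ := exists_exchange (axis_mem_ball_iff (n := n).2 hα)
  have hsc : (s : ℂ) ≠ 0 := by exact_mod_cast hs.ne'
  have hsc' : (1 + s : ℂ) ≠ 0 := by
    have : 1 + s ≠ 0 := by positivity
    exact_mod_cast this
  have hs3 : (starRingEnd ℂ) α * α = 1 - (s : ℂ) ^ 2 := by
    rw [norm_axis, ← Complex.normSq_eq_norm_sq] at hs2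
    rw [mul_comm, Complex.mul_conj, ← Complex.ofReal_pow, hs2]
    push_cast; ring
  refine ⟨T, hT, fun ζ hζ => ?_⟩
  have hd := one_sub_conj_mul_ne_zero hζ hα
  refine act_eq_of_lift (c := -((1 - (starRingEnd ℂ) α * ζ) / s))
    (neg_ne_zero.2 (div_ne_zero hd hsc)) ?_
  rw [h, inner_axis_axis]
  ext1
  · simp only [Prod.smul_mk, Prod.mk_add_mk, ← axis_smul, ← axis_add]
    congr 1
    have hm : mobius α ζ * (1 - (starRingEnd ℂ) α * ζ) = α - ζ := div_mul_cancel₀ _ hd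
    have hm' : -((1 - (starRingEnd ℂ) α * ζ) / s) * mobius α ζ = -((α - ζ) / s) := by
      rw [← hm]; ring
    rw [hm']
    field_simp
    linear_combination ζ * hs3
  · simp only [Prod.smul_mk, Prod.mk_add_mk, smul_eq_mul]
    field_simp
    ring

lemma mobius_mem {α ζ : ℂ} (hα : α ∈ disk) (hζ : ζ ∈ disk) : mobius α ζ ∈ disk := by
  obtain ⟨T, hT, h⟩ := exists_act_mobius (n := 1) hα
  rw [← axis_mem_ball_iff (n := 1), ← h ζ hζ]
  exact act_mem hT (axis_mem_ball_iff.2 hζ)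

lemma mobius_mobius {α ζ : ℂ} (hα : α ∈ disk) (hζ : ζ ∈ disk) : mobius α (mobius α ζ) = ζ := by
  have h1 := one_sub_conj_mul_ne_zero hζ hα
  have h2 := one_sub_conj_mul_ne_zero (mobius_mem hα hζ) hα
  have hm : mobius α ζ * (1 - (starRingEnd ℂ) α * ζ) = α - ζ := div_mul_cancel₀ _ h1
  rw [mobius, div_eq_iff h2]
  refine mul_right_cancel₀ h1 ?_
  linear_combination (-1 + ζ * (starRingEnd ℂ) α) * hm

lemma one_sub_mobius {α ζ : ℂ} (hα : α ∈ disk) (hζ : ζ ∈ disk) :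
    (1 - ‖mobius α ζ‖ ^ 2) * Complex.normSq (1 - (starRingEnd ℂ) α * ζ)
      = (1 - Complex.normSq α) * (1 - ‖ζ‖ ^ 2) := by
  have h1 := (Complex.normSq_pos.2 (one_sub_conj_mul_ne_zero hζ hα)).ne'
  rw [← Complex.normSq_eq_norm_sq, ← Complex.normSq_eq_norm_sq, mobius, Complex.normSq_div,
    sub_mul, div_mul_cancel₀ _ h1]
  simp [Complex.normSq_apply]
  ring

lemma hasFDerivAt_mobius {α ζ : ℂ} (hα : α ∈ disk) (hζ : ζ ∈ disk) :
    HasFDerivAt (mobius α)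
      (planeMap (-(1 - (starRingEnd ℂ) α * α) / (1 - (starRingEnd ℂ) α * ζ) ^ 2)
        (-(1 - (starRingEnd ℂ) α * α) / (1 - (starRingEnd ℂ) α * ζ) ^ 2 * Complex.I)) ζ := by
  have h1 := one_sub_conj_mul_ne_zero hζ hα
  have h2 : HasDerivAt (mobius α)
      (-(1 - (starRingEnd ℂ) α * α) / (1 - (starRingEnd ℂ) α * ζ) ^ 2) ζ := by
    refine (((hasDerivAt_const ζ α).sub (hasDerivAt_id ζ)).div ((hasDerivAt_const ζ (1 : ℂ)).sub
      ((hasDerivAt_id ζ).const_mul ((starRingEnd ℂ) α))) h1).congr_deriv ?_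
    simp
    ring
  refine (h2.hasFDerivAt.restrictScalars ℝ).congr_fderiv ?_
  ext x
  simp [planeMap_apply]
  linear_combination (-(((starRingEnd ℂ) α * α - 1) / (1 - (starRingEnd ℂ) α * ζ) ^ 2))
    * Complex.re_add_im x

/-- Hyperbolic area is invariant under automorphisms of the disk. -/
lemma hypArea_mobius_image {α : ℂ} (hα : α ∈ disk) {S : Set ℂ} (hS : MeasurableSet S)
    (hSd : S ⊆ disk) : hypArea (mobius α '' S) = hypArea S := by
  have hinj : Set.InjOn (mobius α) S := fun ζ hζ ξ hξ h => by
    rw [← mobius_mobius hα (hSd hζ), h, mobius_mobius hα (hSd hξ)]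
  rw [hypArea, MeasureTheory.lintegral_image_eq_lintegral_abs_det_fderiv_mul _ hS
    (fun ζ hζ => (hasFDerivAt_mobius hα (hSd hζ)).hasFDerivWithinAt) hinj, hypArea]
  refine MeasureTheory.setLIntegral_congr_fun hS fun ζ hζ => ?_
  rw [← ENNReal.ofReal_mul (abs_nonneg _)]
  congr 1
  have h1 := Complex.normSq_pos.2 (one_sub_conj_mul_ne_zero (hSd hζ) hα)
  have h2 := one_sub_mobius hα (hSd hζ)
  have h3 : 0 < 1 - Complex.normSq α := by linarith [normSq_lt_one_of_mem_disk hα]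
  have h4 : 0 < 1 - ‖ζ‖ ^ 2 := by
    rw [← Complex.normSq_eq_norm_sq]; linarith [normSq_lt_one_of_mem_disk (hSd hζ)]
  set N := Complex.normSq (1 - (starRingEnd ℂ) α * ζ) with hN
  set A := -(1 - (starRingEnd ℂ) α * α) / (1 - (starRingEnd ℂ) α * ζ) ^ 2 with hA
  have h5 : Complex.normSq A = (1 - Complex.normSq α) ^ 2 / N ^ 2 := by
    have : 1 - (starRingEnd ℂ) α * α = ((1 - Complex.normSq α : ℝ) : ℂ) := by
      rw [mul_comm, Complex.mul_conj]; push_cast; ring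
    rw [hA, this, Complex.normSq_div, Complex.normSq_neg, Complex.normSq_ofReal, map_pow, ← hN]
    ring
  have h6 : (planeMap A (A * Complex.I)).det = Complex.normSq A := by
    rw [planeMap_det, ← mul_assoc, mul_comm _ A, Complex.mul_conj]; simp
  have h7 : 1 - ‖mobius α ζ‖ ^ 2 = (1 - Complex.normSq α) * (1 - ‖ζ‖ ^ 2) / N :=
    eq_div_of_mul_eq h1.ne' h2
  rw [h6, h5, h7, abs_of_nonneg (by positivity)]
  field_simp

section triangle

variable [NeZero n]

lemma solidTriangle_zero_eq {b c : ℂ} (hb : b ∈ disk) (hc : c ∈ disk) :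
    {ζ | ζ ∈ disk ∧ axis n ζ ∈ solidTriangle 0 (axis n b) (axis n c)} = cone b c '' box := by
  have hb' := axis_mem_ball_iff (n := n).2 hb
  have hc' := axis_mem_ball_iff (n := n).2 hc
  ext ζ
  constructor
  · rintro ⟨-, w, hw, hz⟩
    obtain ⟨t, ht, rfl⟩ := (mem_geodesicSegment_iff hb' hc').1 hw
    obtain ⟨s, hs, h⟩ := (mem_geodesicSegment_zero hw.1).1 hz
    rw [geo_axis, ← axis_smul] at h
    exact ⟨⟨s, t⟩, ⟨hs, ht⟩, (axis_injective h).symm⟩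
  · rintro ⟨⟨s, t⟩, ⟨hs, ht⟩, rfl⟩
    have hw := geo_mem_geodesicSegment hb' hc' ht
    have hz : axis n (cone b c ⟨s, t⟩) ∈ geodesicSegment 0 (geo (axis n b) (axis n c) t) :=
      (mem_geodesicSegment_zero hw.1).2 ⟨s, hs, by rw [geo_axis, ← axis_smul]; rfl⟩
    exact ⟨axis_mem_ball_iff.1 hz.1, _, hw, hz⟩

lemma isCompact_box : IsCompact box :=
  Complex.equivRealProdCLM.toHomeomorph.isCompact_preimage.2 isCompact_square

/-- The area of a geodesic triangle in the slice. -/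
lemma hypArea_solidTriangle {a b c : ℂ} (ha : a ∈ disk) (hb : b ∈ disk) (hc : c ∈ disk) :
    hypArea {ζ | ζ ∈ disk ∧ axis n ζ ∈ solidTriangle (axis n a) (axis n b) (axis n c)}
      = ENNReal.ofReal |2 * angularInvariant (axis n a) (axis n b) (axis n c)| := by
  obtain ⟨T, hT, h⟩ := exists_act_mobius (n := n) ha
  have ha' := axis_mem_ball_iff (n := n).2 ha
  have hb' := axis_mem_ball_iff (n := n).2 hb
  have hc' := axis_mem_ball_iff (n := n).2 hc
  have hmb := mobius_mem ha hb
  have hmc := mobius_mem ha hc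
  have hmem : ∀ ζ ∈ disk, (axis n (mobius a ζ) ∈
      solidTriangle 0 (axis n (mobius a b)) (axis n (mobius a c)) ↔
      axis n ζ ∈ solidTriangle (axis n a) (axis n b) (axis n c)) := fun ζ hζ => by
    have := act_mem_solidTriangle_iff hT ha' hb' hc' (axis_mem_ball_iff.2 hζ)
    rwa [h ζ hζ, h a ha, h b hb, h c hc, mobius_self, axis_zero] at this
  -- Since `mobius a` is an involution of the disk, the preimage under it can be written as an
  -- image.
  have hset : {ζ | ζ ∈ disk ∧ axis n ζ ∈ solidTriangle (axis n a) (axis n b) (axis n c)}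
      = mobius a '' {ζ | ζ ∈ disk ∧
        axis n ζ ∈ solidTriangle 0 (axis n (mobius a b)) (axis n (mobius a c))} := by
    ext ζ
    constructor
    · rintro ⟨h1, h2⟩
      exact ⟨mobius a ζ, ⟨mobius_mem ha h1, (hmem ζ h1).2 h2⟩, mobius_mobius ha h1⟩
    · rintro ⟨ξ, ⟨h1, h2⟩, rfl⟩
      refine ⟨mobius_mem ha h1, (hmem _ (mobius_mem ha h1)).1 ?_⟩
      rwa [mobius_mobius ha h1]
  -- Compactness supplies the measurability required by the change of variables.
  have hcomp : IsCompact (cone (mobius a b) (mobius a c) '' box) :=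
    isCompact_box.image_of_continuousOn fun ξ hξ => (hasFDerivAt_cone
      (diskDen_ne_zero_of_mem_box hmb hmc hξ)).continuousAt.continuousWithinAt
  rw [hset, hypArea_mobius_image ha _ fun ζ hζ => hζ.1, solidTriangle_zero_eq hmb hmc,
    hypArea_cone (n := n) hmb hmc, ← angularInvariant_act hT ha' hb' hc', h a ha, h b hb, h c hc,
    mobius_self, axis_zero]
  rw [solidTriangle_zero_eq hmb hmc]
  exact hcomp.measurableSet

/-- One vector on the axis is enough: it is orthogonal to the coordinates that the projection
discards from the other. -/
lemma inner_eq_of_mem_axis {y z : Cn n} (h : y = axis n (y 0) ∨ z = axis n (z 0)) :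
    inner ℂ (axis n (y 0)) (axis n (z 0)) = inner ℂ y z := by
  rcases h with h | h
  · conv_rhs => rw [h]
    rw [inner_axis, inner_axis, axis_apply_zero]
  · conv_rhs => rw [h]
    rw [inner_right_axis, inner_right_axis, axis_apply_zero]

/-- The area of the projection of a triple to a complex geodesic containing two of its points. -/
lemma hypArea_projection {x : Fin 3 → Cn n} (hx : ∀ k, x k ∈ ball n) {i j : Fin 3} (hij : i ≠ j)
    {G : Set (Cn n)} (hiG : x i ∈ G) (hjG : x j ∈ G) {p : Fin 3 → Cn n}
    (hp : ∀ k, IsNearestPoint G (x k) (p k)) {ψ : ℂ → Cn n} (hψ : IsDiskChart ψ G) :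
    hypArea {ζ | ζ ∈ disk ∧ ψ ζ ∈ solidTriangle (p 0) (p 1) (p 2)}
      = ENNReal.ofReal |2 * angularInvariant (x 0) (x 1) (x 2)| := by
  obtain ⟨T, hT, hψT, rfl⟩ := hψ.exists_slice
  set y : Fin 3 → Cn n := fun k => act T.symm (x k) with hy
  have hyb : ∀ k, y k ∈ ball n := fun k => act_mem hT.symm (hx k)
  have hyd : ∀ k, y k 0 ∈ disk := fun k => apply_zero_mem_disk (hyb k)
  have hya : ∀ k, axis n (y k 0) ∈ ball n := fun k => axis_mem_ball_iff.2 (hyd k)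
  have hpk : ∀ k, p k = act T (axis n (y k 0)) := fun k =>
    (isNearestPoint_slice_iff hT (hx k)).1 (hp k)
  have hmem : ∀ k, x k ∈ slice T → y k = axis n (y k 0) := by
    rintro k ⟨ζ, hζ, h⟩
    have : y k = axis n ζ := by
      rw [hy]
      change act T.symm (x k) = _
      rw [← h]
      exact act_symm_act hT (axis_mem_ball_iff.2 hζ)
    rw [this, axis_apply_zero]
  have hinner : ∀ k l : Fin 3, k ≠ l →
      inner ℂ (axis n (y k 0)) (axis n (y l 0)) = inner ℂ (y k) (y l) := fun k l hkl => by
    apply inner_eq_of_mem_axis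
    -- Among three indices, two distinct ones cannot both avoid the pair `i`, `j`.
    have : k = i ∨ k = j ∨ l = i ∨ l = j := by omega
    rcases this with rfl | rfl | rfl | rfl
    exacts [.inl (hmem _ hiG), .inl (hmem _ hjG), .inr (hmem _ hiG), .inr (hmem _ hjG)]
  have hset : {ζ | ζ ∈ disk ∧ ψ ζ ∈ solidTriangle (p 0) (p 1) (p 2)}
      = {ζ | ζ ∈ disk ∧
        axis n ζ ∈ solidTriangle (axis n (y 0 0)) (axis n (y 1 0)) (axis n (y 2 0))} := by
    ext ζ
    refine and_congr_right fun hζ => ?_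
    rw [hψT ζ hζ, hpk, hpk, hpk, act_mem_solidTriangle_iff hT (hya 0) (hya 1) (hya 2)
      (axis_mem_ball_iff.2 hζ)]
  have hang : angularInvariant (axis n (y 0 0)) (axis n (y 1 0)) (axis n (y 2 0))
      = angularInvariant (x 0) (x 1) (x 2) := by
    rw [← angularInvariant_act hT.symm (hx 0) (hx 1) (hx 2), angularInvariant, kernel, kernel,
      kernel, hinner 0 1 (by decide), hinner 1 2 (by decide), hinner 2 0 (by decide)]
    rfl
  rw [hset, hypArea_solidTriangle (hyd 0) (hyd 1) (hyd 2), hang]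

end triangle

end CHyp

end

theorem theorem5p7 (n : ℕ) (x : Fin 3 → CHyp.Cn n) (hx : ∀ k, x k ∈ CHyp.ball n)
    (hinj : Function.Injective x) :
    ∃ SA : ℝ, CHyp.HasSymplecticArea (x 0) (x 1) (x 2) SA ∧
      |SA / 2| = |CHyp.angularInvariant (x 0) (x 1) (x 2)| ∧
      ∀ i j : Fin 3, i ≠ j →
        (∃! G : Set (CHyp.Cn n), CHyp.IsComplexGeodesic G ∧
          CHyp.geodesicSegment (x i) (x j) ⊆ G) ∧
        ∀ G : Set (CHyp.Cn n), CHyp.IsComplexGeodesic G →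
          CHyp.geodesicSegment (x i) (x j) ⊆ G →
          (∀ k, ∃! p, CHyp.IsNearestPoint G (x k) p) ∧
          ∀ p : Fin 3 → CHyp.Cn n, (∀ k, CHyp.IsNearestPoint G (x k) (p k)) →
            ∀ ψ : ℂ → CHyp.Cn n, CHyp.IsDiskChart ψ G →
              CHyp.hypArea {ζ | ζ ∈ CHyp.disk ∧
                ψ ζ ∈ CHyp.solidTriangle (p 0) (p 1) (p 2)} / 2
                = ENNReal.ofReal |SA / 2| := by
  -- In dimension zero the ball is a single point, which has no three distinct points.
  have : NeZero n := ⟨by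
    rintro rfl
    exact absurd (hinj (Subsingleton.elim (x 0) (x 1))) (by decide)⟩
  refine ⟨2 * CHyp.angularInvariant (x 0) (x 1) (x 2),
    CHyp.hasSymplecticArea (hx 0) (hx 1) (hx 2), by rw [mul_div_cancel_left₀ _ two_ne_zero],
    fun i j hij => ⟨CHyp.existsUnique_complexGeodesic (hx i) (hx j) (hinj.ne hij),
      fun G hG hsub => ⟨fun k => ?_, fun p hp ψ hψ => ?_⟩⟩⟩
  · obtain ⟨ψ, hψ⟩ := hG
    obtain ⟨T, hT, -, rfl⟩ := hψ.exists_slice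
    exact ⟨_, (CHyp.isNearestPoint_slice_iff hT (hx k)).2 rfl,
      fun p hp => (CHyp.isNearestPoint_slice_iff hT (hx k)).1 hp⟩
  · rw [CHyp.hypArea_projection hx hij
      (hsub (CHyp.left_mem_geodesicSegment (hx i) (hx j)))
      (hsub (CHyp.right_mem_geodesicSegment (hx i) (hx j))) hp hψ, abs_div,
      ENNReal.ofReal_div_of_pos (by norm_num)]
    norm_num
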